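/- Let $q$ be a complex number with $0<|q|<1$. For $x\in\mathbb C$ and an integer $k\ge 0$ write $(x)_k=\prod_{j=0}^{k-1}(1-xq^j)$ and $(x_1,\dots,x_m)_k=(x_1)_k\cdots(x_m)_k$. Let $r\ge 1$ and $n_1,\dots,n_r\ge 0$ be integers, and let $a,b,c,d,e,f,g$ be nonzero complex numbers with $bcdefg=a^3q^{3-r}$. Suppose that no denominator in the following formula vanishes (in the prefactor, and in the terms of both sums for all $0\le k_i\le n_i$). Then $$ \begin{aligned} &\sum_{\substack{0\le k_i\le n_i\\ i=1,\dots,r}}\ \prod_{1\le i<j\le r}(q^{k_i}-q^{k_j})(1-aq^{k_i+k_j})\\ &\quad\times\prod_{i=1}^r\frac{(1-aq^{2k_i})\,(a,b,c,d,eq^{n_i},f,g,q^{-n_i})_{k_i}}{(1-a)\,(q,aq/b,aq/c,aq/d,aq^{1-n_i}/e,aq/f,aq/g,aq^{1+n_i})_{k_i}}\;q^{\sum_{i=1}^r k_i}\\ &=\left(\frac{a^2q^{4-2r}}{b^2cdfg}\right)^{\binom r2}\prod_{i=1}^{r-1}\frac{(b,c,d,f,g)_i}{(aq^{2-r}/bc,\,aq^{2-r}/bd,\,aq^{2-r}/bf,\,aq^{2-r}/bg,\,a^2q^{4-2r}/bcdfg)_i}\\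 &\quad\times\prod_{i=1}^r\frac{(aq,\,aq^{1-n_i}/ce,\,aq^{1-n_i}/de,\,aq^{1-n_i}/ef,\,aq^{1-n_i}/eg,\,bq^{r-1})_{n_i}}{(aq/c,\,aq/d,\,aq^{1-n_i}/e,\,aq/f,\,aq/g,\,bq^{r-1-n_i}/e)_{n_i}}\,(eq^{n_i})^{n_i}\\ &\quad\times\sum_{\substack{0\le k_i\le n_i\\ i=1,\dots,r}}\ \prod_{1\le i<j\le r}(q^{k_i}-q^{k_j})(1-eq^{1-r+k_i+k_j}/b)\\ &\quad\times\prod_{i=1}^r\frac{(1-eq^{1-r+2k_i}/b)\,(eq^{1-r}/b,\,eq^{1-r}/a,\,aq^{2-r}/bf,\,aq^{2-r}/bg)_{k_i}}{(1-eq^{1-r}/b)\,(q,\,aq/b,\,ef/a,\,eg/a)_{k_i}}\\ &\quad\times\prod_{i=1}^r\frac{(eq^{n_i},\,aq^{2-r}/bc,\,aq^{2-r}/bd,\,q^{-n_i})_{k_i}}{(q^{2-r-n_i}/b,\,ec/a,\,ed/a,\,eq^{2-r+n_i}/b)_{k_i}}\;q^{\sum_{i=1}^r k_i}. \end{aligned}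 $$ -/

import Mathlib

open Finset BigOperators

/-- The `q`-shifted factorial `(a; q)_k = (1 - a)(1 - a q) ⋯ (1 - a q^(k-1))` with base `q`, for a
nonnegative integer index `k`. -/
noncomputable def qPoch (q a : ℂ) (k : ℕ) : ℂ :=
  ∏ j ∈ range k, (1 - a * q ^ j)

/-- The condensed notation `(a₁, …, aₘ; q)_k = (a₁; q)_k ⋯ (aₘ; q)_k`. -/
noncomputable def qPochs (q : ℂ) (as : List ℂ) (k : ℕ) : ℂ :=
  (as.map fun a => qPoch q a k).prod

/-- The factor `∏_{1 ≤ i < j ≤ r} (q^{k_i} - q^{k_j}) (1 - A q^{k_i + k_j})` of a `C_r` series. -/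
noncomputable def crFactor {r : ℕ} (q A : ℂ) (k : Fin r → ℕ) : ℂ :=
  ∏ i, ∏ j ∈ Ioi i, (q ^ k i - q ^ k j) * (1 - A * q ^ (k i + k j))

/-- The multi-indices `k = (k_1, …, k_r)` with `0 ≤ k_i ≤ n_i` for all `i`. -/
def multiBox {r : ℕ} (n : Fin r → ℕ) : Finset (Fin r → ℕ) :=
  Fintype.piFinset fun i => range (n i + 1)

/-! The one-variable engine is Bailey's transformation of terminating balanced very-well-poised
`₁₀φ₉` series (`bailey_transformation`). Its ingredient is Jackson's `₈φ₇` sum (`jackson_sum`): the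
factors containing `b, c, d` are expanded by Jackson's sum, the two summations are exchanged, and
the inner one is again a Jackson sum.

The passage to `r = R + 1` variables is a determinant argument. With `z_i = q^{k_i}`, the type `C`
Vandermonde product is, up to a constant, the determinant of the functions `shiftPoly q a b s z *
shiftPoly q a c (R - s) z` (`exists_det_shiftPoly_eq`). Multiplying a `₁₀φ₉` summand by such a
function merely replaces `b, c` by `b q^s, c q^(R-s)`, so by multilinearity the multiple sum becomes
a determinant of single sums (`shiftPolyDet_mul_crSum`). Since `b q^s * c q^(R-s)` does not depend
on `s`, Bailey's transformation applies to all entries with the same new base `l` and with a factor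
depending only on the row. The transformed determinant is a `C_r` sum with base `l`, which gives
`crSum_transformation`.

The stated formula is this transformation used twice: on the triple `b, c, d`, and then, in the
series with base `l`, on `f, g, l b / a`. The resulting base is `e / (b q^R)`. The intermediate
series demands nonvanishing conditions absent from the theorem, so the identity is proved for
generic parameters (`crLHS_eq_crRHS_of_generic`) and extended by continuity along a weighted curve
through the given parameters, on which generic points are dense (`dense_setOf_genericParams`). -/

open Topology

/-! ### Shifted factorials and genericity modulo powers of `q` -/

theorem qPoch_zero (q a : ℂ) : qPoch q a 0 = 1 := by simp [qPoch]

theorem qPoch_succ (q a : ℂ) (k : ℕ) : qPoch q a (k + 1) = qPoch q a k * (1 - a * q ^ k) := by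
  simp [qPoch, prod_range_succ]

theorem qPoch_add (q a : ℂ) (m k : ℕ) :
    qPoch q a (m + k) = qPoch q a m * qPoch q (a * q ^ m) k := by
  simp only [qPoch, prod_range_add]
  congr 1
  refine prod_congr rfl fun j _ => ?_
  ring

theorem qPoch_succ' (q a : ℂ) (k : ℕ) : qPoch q a (k + 1) = (1 - a) * qPoch q (a * q) k := by
  rw [add_comm, qPoch_add]
  simp [qPoch]

theorem qPochs_nil (q : ℂ) (k : ℕ) : qPochs q [] k = 1 := by simp [qPochs]

theorem qPochs_cons (q a : ℂ) (l : List ℂ) (k : ℕ) :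
    qPochs q (a :: l) k = qPoch q a k * qPochs q l k := by simp [qPochs]

theorem qPochs_zero (q : ℂ) (l : List ℂ) : qPochs q l 0 = 1 := by
  induction l with
  | nil => exact qPochs_nil q 0
  | cons a l ih => rw [qPochs_cons, ih, qPoch_zero, one_mul]

/-- `x` is not an integral power of `q`. -/
def QGeneric (q x : ℂ) : Prop := ∀ j : ℤ, x * q ^ j ≠ 1

namespace QGeneric

variable {q x y : ℂ}

theorem of_eq (h : QGeneric q x) (hq : q ≠ 0) (j : ℤ) (hy : y = x * q ^ j) : QGeneric q y := by
  intro i hi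
  apply h (j + i)
  rw [zpow_add₀ hq, ← mul_assoc, ← hy, hi]

theorem inv (h : QGeneric q x) : QGeneric q x⁻¹ := by
  intro j hj
  apply h (-j)
  rw [zpow_neg, ← inv_inj, mul_inv, inv_inv, hj, inv_one]

theorem one_sub_ne_zero (h : QGeneric q x) : 1 - x ≠ 0 := by
  intro hx
  apply h 0
  rw [zpow_zero, mul_one]
  linear_combination -hx

theorem one_sub_mul_pow_ne_zero (h : QGeneric q x) (k : ℕ) : 1 - x * q ^ k ≠ 0 := by
  intro hx
  apply h k
  rw [zpow_natCast]
  linear_combination -hx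

theorem qPoch_ne_zero (h : QGeneric q x) (k : ℕ) : qPoch q x k ≠ 0 :=
  prod_ne_zero_iff.2 fun j _ => h.one_sub_mul_pow_ne_zero j

end QGeneric

theorem one_sub_pow_ne_zero {q : ℂ} (hq1 : ‖q‖ < 1) {m : ℕ} (hm : m ≠ 0) : 1 - q ^ m ≠ 0 := by
  intro h
  have h1 : ‖q‖ ^ m = 1 := by
    rw [← norm_pow, ← sub_eq_zero.1 h, norm_one]
  exact (pow_lt_one₀ (norm_nonneg q) hq1 hm).ne h1

theorem qPoch_self_ne_zero {q : ℂ} (hq1 : ‖q‖ < 1) (k : ℕ) : qPoch q q k ≠ 0 :=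
  prod_ne_zero_iff.2 fun j _ => by
    rw [← pow_succ']
    exact one_sub_pow_ne_zero hq1 j.succ_ne_zero

theorem qPoch_inv_pow_eq_zero {q : ℂ} (hq0 : q ≠ 0) {n k : ℕ} (h : n < k) :
    qPoch q (q ^ n)⁻¹ k = 0 := by
  refine prod_eq_zero (mem_range.2 h) ?_
  rw [inv_mul_cancel₀ (pow_ne_zero _ hq0), sub_self]

/-! ### Jackson's `₈φ₇` summation by telescoping -/

/-- The summand of a terminating very-well-poised `₈φ₇` series. -/
noncomputable def jacksonTerm (q a b c d e : ℂ) (n k : ℕ) : ℂ :=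
  (1 - a * q ^ (2 * k)) / (1 - a) *
    (qPoch q a k * qPoch q b k * qPoch q c k * qPoch q d k * qPoch q e k * qPoch q (q ^ n)⁻¹ k) /
    (qPoch q q k * qPoch q (a * q / b) k * qPoch q (a * q / c) k * qPoch q (a * q / d) k *
      qPoch q (a * q / e) k * qPoch q (a * q ^ (n + 1)) k) * q ^ k

/-- The telescoping step for Jackson's sum with denominators and the common factor `(1 - b)(1 - c)(1
- d)` removed; `u` stands for `q^(k+1)` and `x` for `a q^(n+1)`. -/
theorem jackson_polynomial_identity (a b c d x u : ℂ) :
    (1 - a * u ^ 2) * u * (-((b - x) * (c - x) * (d - x) * (b * c * d - a * x * u) * (x - a) *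
      (x - b * c * d * u)) - (b * c - x) * (b * d - x) * (c * d - x) * (b * c * d - a * x) *
      (x - a * u) * (1 - x * u)) =
    -(x * (b * c * d - x ^ 2) * ((1 - a * u) * (1 - b * u) * (1 - c * u) * (1 - d * u) *
      (b * c * d - a * x * u) * (x - a * u) - (1 - u) * (b - a * u) * (c - a * u) * (d - a * u) *
      (x - b * c * d * u) * (1 - x * u))) := by
  ring

/-- Everything is divided by the companion at `k`: the left side is the summand of order `n + 1`
minus `ρ` times that of order `n`, both at `k + 1`, and the right side is the increment of `(1 - ρ)`
times the companion. -/
theorem jackson_rational_identity {a b c d x u ρ : ℂ} (hb : b ≠ 0) (hc : c ≠ 0)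
    (hd : d ≠ 0) (hx : x ≠ 0)
    (h1 : 1 - u ≠ 0) (h2 : b - a * u ≠ 0) (h3 : c - a * u ≠ 0)
    (h4 : d - a * u ≠ 0) (h6 : x - b * c * d * u ≠ 0)
    (h7 : 1 - x ≠ 0) (h8 : 1 - x * u ≠ 0)
    (h9 : b - x ≠ 0) (h10 : c - x ≠ 0) (h11 : d - x ≠ 0) (h12 : b * c * d - x ≠ 0)
    (hρ : ρ = (1 - x) * (b * c - x) * (b * d - x) * (c * d - x) /
      ((b - x) * (c - x) * (d - x) * (b * c * d - x))) :
    (1 - a * u ^ 2) * ((1 - b) * (1 - c) * (1 - d) * (1 - a * x * u / (b * c * d))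
        * (1 - a / x)) * u /
      ((1 - u) * (1 - a * u / b) * (1 - a * u / c) * (1 - a * u / d) *
        (1 - b * c * d / x) * (1 - x * u)) -
      ρ * ((1 - a * u ^ 2) * ((1 - b) * (1 - c) * (1 - d) * (1 - a * x / (b * c * d))
        * (1 - a * u / x)) * u /
      ((1 - u) * (1 - a * u / b) * (1 - a * u / c) * (1 - a * u / d) *
        (1 - b * c * d * u / x) * (1 - x))) =
    (1 - ρ) * ((1 - a * u) * (1 - b * u) * (1 - c * u) * (1 - d * u) *
      (1 - a * x * u / (b * c * d)) * (1 - a * u / x) /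
      ((1 - u) * (1 - a * u / b) * (1 - a * u / c) * (1 - a * u / d) *
        (1 - b * c * d * u / x) * (1 - x * u)) - 1) := by
  have key := jackson_polynomial_identity a b c d x u
  -- This factorization of `1 - ρ` supplies the factor `(1 - b)(1 - c)(1 - d)` that the two summands
  -- on the left already carry.
  have hρ' : 1 - ρ = -(x * (1 - b) * (1 - c) * (1 - d) * (b * c * d - x ^ 2)) /
      ((b - x) * (c - x) * (d - x) * (b * c * d - x)) := by
    rw [hρ, eq_div_iff (by simp [h9, h10, h11, h12]), sub_mul, div_mul_cancel₀]
    · ring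
    · simp [h9, h10, h11, h12]
  have hbcd : b * c * d ≠ 0 := mul_ne_zero (mul_ne_zero hb hc) hd
  rw [hρ', hρ]
  have e1 : 1 - a * u / b = (b - a * u) / b := by rw [sub_div, div_self hb]
  have e2 : 1 - a * u / c = (c - a * u) / c := by rw [sub_div, div_self hc]
  have e3 : 1 - a * u / d = (d - a * u) / d := by rw [sub_div, div_self hd]
  have e4 : 1 - a * u / x = (x - a * u) / x := by rw [sub_div, div_self hx]
  have e5 : 1 - a / x = (x - a) / x := by rw [sub_div, div_self hx]
  have e6 : 1 - b * c * d / x = -(b * c * d - x) / x := by rw [neg_sub, sub_div, div_self hx]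
  have e7 : 1 - b * c * d * u / x = (x - b * c * d * u) / x := by rw [sub_div, div_self hx]
  have e8 : 1 - a * x * u / (b * c * d) = (b * c * d - a * x * u) / (b * c * d) := by
    rw [sub_div, div_self hbcd]
  have e9 : 1 - a * x / (b * c * d) = (b * c * d - a * x) / (b * c * d) := by
    rw [sub_div, div_self hbcd]
  rw [e1, e2, e3, e4, e5, e6, e7, e8, e9]
  -- With every linear factor an opaque atom, clearing denominators leaves exactly the polynomial
  -- identity.
  generalize hB : b - a * u = B at *
  generalize hC : c - a * u = C at *
  generalize hD : d - a * u = D at *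
  generalize hX : x - a * u = X at *
  generalize hX1 : x - a = X1 at *
  generalize b * c * d - a * x * u = Y at *
  generalize b * c * d - a * x = Y1 at *
  generalize x - b * c * d * u = Z at *
  generalize b * c * d - x ^ 2 = W at *
  generalize b * c * d - x = V at *
  generalize b - x = B1 at *
  generalize c - x = C1 at *
  generalize d - x = D1 at *
  generalize b * c - x = B2 at *
  generalize b * d - x = C2 at *
  generalize c * d - x = D2 at *
  generalize 1 - x * u = T at *
  generalize 1 - x = T1 at *
  generalize 1 - u = T2 at *
  generalize 1 - a * u ^ 2 = G at *
  generalize 1 - a * u = G0 at *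
  generalize 1 - b * u = G1 at *
  generalize 1 - c * u = G2 at *
  generalize 1 - d * u = G3 at *
  generalize 1 - b = b' at *
  generalize 1 - c = c' at *
  generalize 1 - d = d' at *
  field_simp
  linear_combination b' * c' * d' * key

/-- The telescoping companion of the terminating very-well-poised `₈φ₇` summand. -/
noncomputable def jacksonCompanion (q a b c d x : ℂ) (n k : ℕ) : ℂ :=
  (qPoch q (a * q) k * qPoch q (b * q) k * qPoch q (c * q) k * qPoch q (d * q) k *
      qPoch q (a * x * q / (b * c * d)) k * qPoch q (q ^ n)⁻¹ k) /
    (qPoch q q k * qPoch q (a * q / b) k * qPoch q (a * q / c) k * qPoch q (a * q / d) k *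
      qPoch q (b * c * d / x * q) k * qPoch q (x * q) k)

theorem div_mul_div_regroup {A D G K N N' P Q R S : ℂ} (hA : A ≠ 0) (hN : N = A * N')
    (h : G * N' * K = P * R) (hD : D = Q * S) : G / A * N * K / D = P / Q * (R / S) := by
  rw [div_mul_div_comm, ← h, hD, hN]
  congr 1
  field_simp

/-- The last parameter `a x q / (b c d)` is the balanced value for order `n + 1`; for order `n` it
is `a x / (b c d)`. The companion is built so that the ratio of either summand to it is a rational
function of `q^(k+1)`. -/
theorem jacksonTerm_succ_succ {q a b c d x : ℂ} (hq : q ≠ 0) (ha1 : 1 - a ≠ 0)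
    (ha : a ≠ 0) (hb : b ≠ 0) (hc : c ≠ 0) (hd : d ≠ 0) {n : ℕ} (hx : x = a * q ^ (n + 1)) (k : ℕ) :
    jacksonTerm q a b c d (a * x * q / (b * c * d)) (n + 1) (k + 1) =
      jacksonCompanion q a b c d x n k *
        ((1 - a * (q ^ (k + 1)) ^ 2) * ((1 - b) * (1 - c) * (1 - d) *
          (1 - a * x * q ^ (k + 1) / (b * c * d)) * (1 - a / x)) * q ^ (k + 1) /
        ((1 - q ^ (k + 1)) * (1 - a * q ^ (k + 1) / b) * (1 - a * q ^ (k + 1) / c) *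
          (1 - a * q ^ (k + 1) / d) * (1 - b * c * d / x) * (1 - x * q ^ (k + 1)))) := by
  have hx0 : x ≠ 0 := by rw [hx]; exact mul_ne_zero ha (pow_ne_zero _ hq)
  have e1 : a * q / (a * x * q / (b * c * d)) = b * c * d / x := by field_simp
  have e2 : (q ^ (n + 1))⁻¹ * q = (q ^ n)⁻¹ := by rw [pow_succ]; field_simp
  have e3 : (q ^ (n + 1))⁻¹ = a / x := by rw [hx]; field_simp
  have e4 : a * q ^ (n + 1 + 1) = x * q := by rw [hx]; ring
  simp only [jacksonTerm, jacksonCompanion, e1, e4]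
  rw [div_mul_eq_mul_div (_ * _) (_ * _) (q ^ (k + 1)),
    qPoch_succ' q a, qPoch_succ' q b, qPoch_succ' q c, qPoch_succ' q d,
    qPoch_succ q (a * x * q / (b * c * d)), qPoch_succ' q (q ^ (n + 1))⁻¹, e2,
    e3,
    qPoch_succ q q, qPoch_succ q (a * q / b), qPoch_succ q (a * q / c), qPoch_succ q (a * q / d),
    qPoch_succ' q (b * c * d / x), qPoch_succ q (x * q)]
  have f1 : a * x * q / (b * c * d) * q ^ k = a * x * q ^ (k + 1) / (b * c * d) := by ring
  have f2 : a * q / b * q ^ k = a * q ^ (k + 1) / b := by ring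
  have f3 : a * q / c * q ^ k = a * q ^ (k + 1) / c := by ring
  have f4 : a * q / d * q ^ k = a * q ^ (k + 1) / d := by ring
  have f5 : x * q * q ^ k = x * q ^ (k + 1) := by ring
  have f6 : q ^ (2 * (k + 1)) = (q ^ (k + 1)) ^ 2 := by ring
  rw [f1, f2, f3, f4, f5, f6, ← pow_succ']
  generalize 1 - a = A at *
  generalize qPoch q (a * q) k = A1
  generalize qPoch q (b * q) k = B1
  generalize qPoch q (c * q) k = C1
  generalize qPoch q (d * q) k = D1
  generalize qPoch q (a * x * q / (b * c * d)) k = E1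
  generalize qPoch q (q ^ n)⁻¹ k = F1
  generalize qPoch q q k = A2
  generalize qPoch q (a * q / b) k = B2
  generalize qPoch q (a * q / c) k = C2
  generalize qPoch q (a * q / d) k = D2
  generalize qPoch q (b * c * d / x * q) k = E2
  generalize qPoch q (x * q) k = F2
  generalize 1 - b = B at *
  generalize 1 - c = C at *
  generalize 1 - d = D at *
  generalize 1 - a * (q ^ (k + 1)) ^ 2 = G
  generalize 1 - a * q ^ (k + 1) / b = B3
  generalize 1 - a * q ^ (k + 1) / c = C3
  generalize 1 - a * q ^ (k + 1) / d = D3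
  generalize 1 - b * c * d / x = E3
  generalize 1 - x * q ^ (k + 1) = F3
  generalize 1 - a / x = H1
  generalize 1 - q ^ (k + 1) = H2
  generalize 1 - a * x * q ^ (k + 1) / (b * c * d) = H3
  generalize q ^ (k + 1) = K
  exact div_mul_div_regroup (N' := A1 * (B * B1) * (C * C1) * (D * D1) * (E1 * H3) * (H1 * F1))
    ha1 (by ring) (by ring) (by ring)

theorem jacksonTerm_succ {q a b c d x : ℂ} (hq : q ≠ 0) (ha1 : 1 - a ≠ 0)
    (ha : a ≠ 0) (hb : b ≠ 0) (hc : c ≠ 0) (hd : d ≠ 0) {n : ℕ} (hx : x = a * q ^ (n + 1)) (k : ℕ) :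
    jacksonTerm q a b c d (a * x / (b * c * d)) n (k + 1) =
      jacksonCompanion q a b c d x n k *
        ((1 - a * (q ^ (k + 1)) ^ 2) * ((1 - b) * (1 - c) * (1 - d) *
          (1 - a * x / (b * c * d)) * (1 - a * q ^ (k + 1) / x)) * q ^ (k + 1) /
        ((1 - q ^ (k + 1)) * (1 - a * q ^ (k + 1) / b) * (1 - a * q ^ (k + 1) / c) *
          (1 - a * q ^ (k + 1) / d) * (1 - b * c * d * q ^ (k + 1) / x) * (1 - x))) := by
  have hx0 : x ≠ 0 := by rw [hx]; exact mul_ne_zero ha (pow_ne_zero _ hq)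
  have e1 : a * q / (a * x / (b * c * d)) = b * c * d / x * q := by field_simp
  have e2 : a * x / (b * c * d) * q = a * x * q / (b * c * d) := by ring
  have e3 : (q ^ n)⁻¹ * q ^ k = a * q ^ (k + 1) / x := by
    rw [hx, pow_succ, pow_succ]; field_simp
  simp only [jacksonTerm, jacksonCompanion, e1, ← hx]
  rw [div_mul_eq_mul_div (_ * _) (_ * _) (q ^ (k + 1)),
    qPoch_succ' q a, qPoch_succ' q b, qPoch_succ' q c, qPoch_succ' q d,
    qPoch_succ' q (a * x / (b * c * d)), e2, qPoch_succ q (q ^ n)⁻¹, e3,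
    qPoch_succ q q, qPoch_succ q (a * q / b), qPoch_succ q (a * q / c), qPoch_succ q (a * q / d),
    qPoch_succ q (b * c * d / x * q), qPoch_succ' q x]
  have f1 : b * c * d / x * q * q ^ k = b * c * d * q ^ (k + 1) / x := by ring
  have f2 : a * q / b * q ^ k = a * q ^ (k + 1) / b := by ring
  have f3 : a * q / c * q ^ k = a * q ^ (k + 1) / c := by ring
  have f4 : a * q / d * q ^ k = a * q ^ (k + 1) / d := by ring
  have f6 : q ^ (2 * (k + 1)) = (q ^ (k + 1)) ^ 2 := by ring
  rw [f1, f2, f3, f4, f6, ← pow_succ']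
  generalize 1 - a = A at *
  generalize qPoch q (a * q) k = A1
  generalize qPoch q (b * q) k = B1
  generalize qPoch q (c * q) k = C1
  generalize qPoch q (d * q) k = D1
  generalize qPoch q (a * x * q / (b * c * d)) k = E1
  generalize qPoch q (q ^ n)⁻¹ k = F1
  generalize qPoch q q k = A2
  generalize qPoch q (a * q / b) k = B2
  generalize qPoch q (a * q / c) k = C2
  generalize qPoch q (a * q / d) k = D2
  generalize qPoch q (b * c * d / x * q) k = E2
  generalize qPoch q (x * q) k = F2
  generalize 1 - b = B at *
  generalize 1 - c = C at *
  generalize 1 - d = D at *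
  generalize 1 - a * (q ^ (k + 1)) ^ 2 = G
  generalize 1 - a * q ^ (k + 1) / b = B3
  generalize 1 - a * q ^ (k + 1) / c = C3
  generalize 1 - a * q ^ (k + 1) / d = D3
  generalize 1 - a * q ^ (k + 1) / x = E3
  generalize 1 - x = H1
  generalize 1 - q ^ (k + 1) = H2
  generalize 1 - b * c * d * q ^ (k + 1) / x = F3
  generalize 1 - a * x / (b * c * d) = H3
  generalize q ^ (k + 1) = K
  exact div_mul_div_regroup (N' := A1 * (B * B1) * (C * C1) * (D * D1) * (H3 * E1) * (F1 * E3))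
    ha1 (by ring) (by ring) (by ring)

theorem jacksonCompanion_succ {q a b c d x : ℂ} (hq : q ≠ 0) (ha : a ≠ 0)
    {n : ℕ} (hx : x = a * q ^ (n + 1)) (k : ℕ) :
    jacksonCompanion q a b c d x n (k + 1) =
      jacksonCompanion q a b c d x n k *
        ((1 - a * q ^ (k + 1)) * (1 - b * q ^ (k + 1)) * (1 - c * q ^ (k + 1)) *
          (1 - d * q ^ (k + 1)) * (1 - a * x * q ^ (k + 1) / (b * c * d)) *
          (1 - a * q ^ (k + 1) / x) /
        ((1 - q ^ (k + 1)) * (1 - a * q ^ (k + 1) / b) * (1 - a * q ^ (k + 1) / c) *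
          (1 - a * q ^ (k + 1) / d) * (1 - b * c * d * q ^ (k + 1) / x) *
          (1 - x * q ^ (k + 1)))) := by
  have e3 : (q ^ n)⁻¹ * q ^ k = a * q ^ (k + 1) / x := by
    rw [hx, pow_succ, pow_succ]; field_simp
  simp only [jacksonCompanion, qPoch_succ, e3, ← pow_succ', mul_assoc _ q (q ^ k)]
  have f0 : a * x * q / (b * c * d) * q ^ k = a * x * q ^ (k + 1) / (b * c * d) := by ring
  have f1 : b * c * d / x * q ^ (k + 1) = b * c * d * q ^ (k + 1) / x := by ring
  have f2 : a * q / b * q ^ k = a * q ^ (k + 1) / b := by ring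
  have f3 : a * q / c * q ^ k = a * q ^ (k + 1) / c := by ring
  have f4 : a * q / d * q ^ k = a * q ^ (k + 1) / d := by ring
  rw [f0, f1, f2, f3, f4, ← mul_div_mul_comm]
  congr 1 <;> ac_rfl

/-- The ratio of consecutive values of the terminating `₈φ₇` sum, with `x = a q^(n+1)`. -/
noncomputable def jacksonRatio (b c d x : ℂ) : ℂ :=
  (1 - x) * (b * c - x) * (b * d - x) * (c * d - x) /
      ((b - x) * (c - x) * (d - x) * (b * c * d - x))

/-- The difference of consecutive orders is a telescoping series in `j`. At `k = n + 1` the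
companion vanishes, which leaves a first-order recurrence in `n` for Jackson's sum. -/
theorem sum_jacksonTerm_sub {q a b c d x : ℂ} (hq : q ≠ 0) (hq1 : ‖q‖ < 1)
    (ha : a ≠ 0) (hb : b ≠ 0) (hc : c ≠ 0) (hd : d ≠ 0) (hA : QGeneric q a)
    (hB : QGeneric q (a / b)) (hC : QGeneric q (a / c)) (hD : QGeneric q (a / d))
    (hE : QGeneric q (a / (b * c * d))) {n : ℕ} (hx : x = a * q ^ (n + 1)) (k : ℕ) :
    ∑ j ∈ range (k + 1), (jacksonTerm q a b c d (a * x * q / (b * c * d)) (n + 1) j -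
        jacksonRatio b c d x * jacksonTerm q a b c d (a * x / (b * c * d)) n j) =
      (1 - jacksonRatio b c d x) * jacksonCompanion q a b c d x n k := by
  induction k with
  | zero => simp [jacksonTerm, jacksonCompanion, qPoch_zero, hA.one_sub_ne_zero]
  | succ k ih =>
    rw [sum_range_succ, ih, jacksonTerm_succ_succ hq hA.one_sub_ne_zero ha hb hc hd hx,
      jacksonTerm_succ hq hA.one_sub_ne_zero ha hb hc hd hx, jacksonCompanion_succ hq ha hx]
    have hx0 : x ≠ 0 := by rw [hx]; exact mul_ne_zero ha (pow_ne_zero _ hq)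
    have aux : ∀ {y : ℂ}, y ≠ 0 → QGeneric q (a / y) → ∀ m : ℕ, y - a * q ^ m ≠ 0 := by
      intro y hy h m h0
      apply h.one_sub_mul_pow_ne_zero m
      rw [div_mul_eq_mul_div, ← sub_eq_zero.1 h0, div_self hy, sub_self]
    have hbcd : b * c * d ≠ 0 := mul_ne_zero (mul_ne_zero hb hc) hd
    have h6 : x - b * c * d * q ^ (k + 1) ≠ 0 := by
      intro h0
      apply hE ((n : ℤ) - k)
      have h1 : a * q ^ (n + 1) = b * c * d * q ^ (k + 1) := by
        rw [← hx]; exact sub_eq_zero.1 h0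
      have h2 : a * q ^ n = b * c * d * q ^ k := by
        apply mul_right_cancel₀ hq
        linear_combination h1
      rw [zpow_sub₀ hq, zpow_natCast, zpow_natCast, div_mul_div_comm, h2, div_self]
      exact mul_ne_zero hbcd (pow_ne_zero _ hq)
    have key := jackson_rational_identity (a := a) (u := q ^ (k + 1)) hb hc hd hx0
      (one_sub_pow_ne_zero hq1 k.succ_ne_zero) (aux hb hB _) (aux hc hC _) (aux hd hD _) h6
      (by rw [hx]; exact hA.one_sub_mul_pow_ne_zero _)
      (by rw [hx, mul_assoc, ← pow_add]; exact hA.one_sub_mul_pow_ne_zero _)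
      (by rw [hx]; exact aux hb hB _) (by rw [hx]; exact aux hc hC _)
      (by rw [hx]; exact aux hd hD _) (by rw [hx]; exact aux hbcd hE _)
      (ρ := jacksonRatio b c d x) rfl
    linear_combination jacksonCompanion q a b c d x n k * key

/-- Jackson's summation of the terminating balanced very-well-poised `₈φ₇` series. -/
theorem jackson_sum {q a b c d : ℂ} (hq : q ≠ 0) (hq1 : ‖q‖ < 1)
    (ha : a ≠ 0) (hb : b ≠ 0) (hc : c ≠ 0) (hd : d ≠ 0) (hA : QGeneric q a)
    (hB : QGeneric q (a / b)) (hC : QGeneric q (a / c)) (hD : QGeneric q (a / d))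
    (hE : QGeneric q (a / (b * c * d))) (n : ℕ) :
    ∑ k ∈ range (n + 1), jacksonTerm q a b c d (a ^ 2 * q ^ (n + 1) / (b * c * d)) n k =
      qPoch q (a * q) n * qPoch q (a * q / (b * c)) n * qPoch q (a * q / (b * d)) n *
        qPoch q (a * q / (c * d)) n /
      (qPoch q (a * q / b) n * qPoch q (a * q / c) n * qPoch q (a * q / d) n *
        qPoch q (a * q / (b * c * d)) n) := by
  induction n with
  | zero => simp [jacksonTerm, qPoch_zero, hA.one_sub_ne_zero]
  | succ n ih =>
    have h := sum_jacksonTerm_sub hq hq1 ha hb hc hd hA hB hC hD hE (n := n) rfl (n + 1)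
    have h0 : jacksonCompanion q a b c d (a * q ^ (n + 1)) n (n + 1) = 0 := by
      simp [jacksonCompanion, qPoch_inv_pow_eq_zero hq n.lt_succ_self]
    -- Extending the sum of order `n` by one zero term gives both sums the same range.
    have h1 : ∀ e, jacksonTerm q a b c d e n (n + 1) = 0 := by
      intro e
      simp [jacksonTerm, qPoch_inv_pow_eq_zero hq n.lt_succ_self]
    have e1 : a * (a * q ^ (n + 1)) * q / (b * c * d) = a ^ 2 * q ^ (n + 1 + 1) / (b * c * d) := by
      ring
    have e2 : a * (a * q ^ (n + 1)) / (b * c * d) = a ^ 2 * q ^ (n + 1) / (b * c * d) := by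
      ring
    rw [h0, mul_zero, sum_sub_distrib, ← mul_sum, sum_range_succ _ (n + 1),
      sum_range_succ _ (n + 1), h1, add_zero, ← sum_range_succ, e1, e2, ih, sub_eq_zero] at h
    rw [h]
    have aux : ∀ {y : ℂ}, y ≠ 0 → 1 - a * q / y * q ^ n = (y - a * q ^ (n + 1)) / y := by
      intro y hy
      rw [eq_div_iff hy]
      field_simp
      ring
    have aux2 : 1 - a * q * q ^ n = 1 - a * q ^ (n + 1) := by ring
    simp only [qPoch_succ, jacksonRatio]
    rw [aux hb, aux hc, aux hd, aux (mul_ne_zero hb hc), aux (mul_ne_zero hb hd),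
      aux (mul_ne_zero hc hd), aux (mul_ne_zero (mul_ne_zero hb hc) hd), aux2]
    generalize 1 - a * q ^ (n + 1) = X1
    generalize b - a * q ^ (n + 1) = X2
    generalize c - a * q ^ (n + 1) = X3
    generalize d - a * q ^ (n + 1) = X4
    generalize b * c - a * q ^ (n + 1) = X5
    generalize b * d - a * q ^ (n + 1) = X6
    generalize c * d - a * q ^ (n + 1) = X7
    generalize b * c * d - a * q ^ (n + 1) = X8
    rw [← mul_div_mul_comm]
    have hbcd : b * c * d * (b * c * d) ≠ 0 :=
      mul_ne_zero (mul_ne_zero (mul_ne_zero hb hc) hd) (mul_ne_zero (mul_ne_zero hb hc) hd)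
    -- The denominators `bc, bd, cd` above and `b, c, d, bcd` below have the same product `(bcd)^2`.
    refine Eq.trans (mul_div_mul_right _ _ (inv_ne_zero hbcd)).symm ?_
    refine congrArg₂ (· / ·) ?_ ?_ <;> simp only [div_eq_mul_inv, mul_inv] <;> ring

/-! ### Bailey's `₁₀φ₉` transformation -/

/-- Reversing the order of the factors. The product of the `-(q^i / q^j)` is free of `y`, so it
cancels whenever equally many reversed factorials are compared. -/
theorem qPoch_inv_mul_pow {q y : ℂ} (hq : q ≠ 0) (hy : y ≠ 0) (j : ℕ) :
    y ^ j * qPoch q (y * q ^ j)⁻¹ j = (∏ i ∈ range j, -(q ^ i / q ^ j)) * qPoch q (y * q) j := by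
  have h : qPoch q (y * q) j = ∏ i ∈ range j, (1 - y * q ^ j / q ^ i) := by
    rw [qPoch, ← prod_range_reflect]
    refine prod_congr rfl fun i hi => ?_
    have hi' : j = (j - 1 - i) + 1 + i := by have := mem_range.1 hi; omega
    have e : q ^ j = q ^ (j - 1 - i) * q * q ^ i := by
      conv_lhs => rw [hi', pow_add, pow_succ]
    rw [e]
    field_simp
  have h2 : y ^ j = ∏ _i ∈ range j, y := by simp
  rw [h, h2, qPoch, ← prod_mul_distrib, ← prod_mul_distrib]
  refine prod_congr rfl fun i _ => ?_
  field_simp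
  ring

theorem pow_mul_qPoch_inv_mul_pow {q y z : ℂ} (hq : q ≠ 0) (hy : y ≠ 0) (hz : z ≠ 0) (j : ℕ) :
    y ^ j * qPoch q (y * q ^ j)⁻¹ j * qPoch q (z * q) j =
      z ^ j * qPoch q (z * q ^ j)⁻¹ j * qPoch q (y * q) j := by
  rw [qPoch_inv_mul_pow hq hy, qPoch_inv_mul_pow hq hz]
  ring

/-- The summand of a terminating very-well-poised `₁₀φ₉` series. -/
noncomputable def baileyTerm (q a b c d e f g : ℂ) (n k : ℕ) : ℂ :=
  (1 - a * q ^ (2 * k)) / (1 - a) *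
    (qPoch q a k * qPoch q b k * qPoch q c k * qPoch q d k * qPoch q e k * qPoch q f k *
      qPoch q g k * qPoch q (q ^ n)⁻¹ k) /
    (qPoch q q k * qPoch q (a * q / b) k * qPoch q (a * q / c) k * qPoch q (a * q / d) k *
      qPoch q (a * q / e) k * qPoch q (a * q / f) k * qPoch q (a * q / g) k *
      qPoch q (a * q ^ (n + 1)) k) * q ^ k

/-- Jackson's sum with base `l`, parameters `l b / a, l c / a, l d / a` and order `k`. The choice of
`l` turns the quotients `l q / (l b / a * (l c / a))` and its two analogues into `d, c, b`, and the
balanced last parameter into `a q^k`. -/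
theorem qPoch_triple_expansion {q a b c d l : ℂ} (hq : q ≠ 0) (hq1 : ‖q‖ < 1)
    (ha : a ≠ 0) (hb : b ≠ 0) (hc : c ≠ 0) (hd : d ≠ 0) (hl : l = a ^ 2 * q / (b * c * d))
    (hL : QGeneric q l) (hB : QGeneric q (a / b)) (hC : QGeneric q (a / c))
    (hD : QGeneric q (a / d)) (hE : QGeneric q (a / l)) (k : ℕ) :
    qPoch q b k * qPoch q c k * qPoch q d k /
        (qPoch q (a * q / b) k * qPoch q (a * q / c) k * qPoch q (a * q / d) k) =
      qPoch q (a / l) k / qPoch q (l * q) k *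
        ∑ j ∈ range (k + 1),
          jacksonTerm q l (l * b / a) (l * c / a) (l * d / a) (a * q ^ k) k j := by
  have hl0 : l ≠ 0 := by rw [hl]; positivity
  have hbcd : b * c * d = a ^ 2 * q / l := by rw [hl]; field_simp
  have e1 : l / (l * b / a) = a / b := by field_simp
  have e2 : l / (l * c / a) = a / c := by field_simp
  have e3 : l / (l * d / a) = a / d := by field_simp
  have e4 : l / (l * b / a * (l * c / a) * (l * d / a)) * q ^ (1 : ℤ) = a / l := by
    rw [show l * b / a * (l * c / a) * (l * d / a) = l ^ 3 * (b * c * d) / a ^ 3 by ring, hbcd,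
      zpow_one]
    field_simp
  have hE' : QGeneric q (l / (l * b / a * (l * c / a) * (l * d / a))) :=
    hE.of_eq hq (-1) (by rw [← e4, zpow_one, zpow_neg_one, mul_inv_cancel_right₀ hq])
  have := jackson_sum hq hq1 hl0 (div_ne_zero (mul_ne_zero hl0 hb) ha)
    (div_ne_zero (mul_ne_zero hl0 hc) ha) (div_ne_zero (mul_ne_zero hl0 hd) ha) hL
    (by rwa [e1]) (by rwa [e2]) (by rwa [e3]) hE' k
  have f0 : l ^ 2 * q ^ (k + 1) / (l * b / a * (l * c / a) * (l * d / a)) = a * q ^ k := by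
    rw [show l * b / a * (l * c / a) * (l * d / a) = l ^ 3 * (b * c * d) / a ^ 3 by ring, hbcd]
    field_simp
    ring
  have f1 : l * q / (l * b / a) = a * q / b := by field_simp
  have f2 : l * q / (l * c / a) = a * q / c := by field_simp
  have f3 : l * q / (l * d / a) = a * q / d := by field_simp
  have f4 : l * q / (l * b / a * (l * c / a)) = d := by rw [hl]; field_simp
  have f5 : l * q / (l * b / a * (l * d / a)) = c := by rw [hl]; field_simp
  have f6 : l * q / (l * c / a * (l * d / a)) = b := by rw [hl]; field_simp
  have f7 : l * q / (l * b / a * (l * c / a) * (l * d / a)) = a / l := by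
    rw [← e4, zpow_one]; ring
  rw [f0, f1, f2, f3, f4, f5, f6, f7] at this
  rw [this]
  have h1 : qPoch q (l * q) k ≠ 0 := (hL.of_eq hq 1 (by simp)).qPoch_ne_zero k
  have h2 := hE.qPoch_ne_zero k
  rw [div_mul_div_comm]
  refine Eq.trans (mul_div_mul_left _ _ (mul_ne_zero h1 h2)).symm ?_
  refine congrArg₂ (· / ·) ?_ ?_ <;> ring

/-- The part of the `j`-th term of the expanded `₁₀φ₉` series which is free of the inner summation
index. -/
noncomputable def baileyCoeff (q a b c d e f g l : ℂ) (n j : ℕ) : ℂ :=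
  (1 - l * q ^ (2 * j)) / (1 - l) *
    (qPoch q l j * qPoch q (l * b / a) j * qPoch q (l * c / a) j * qPoch q (l * d / a) j) /
    (qPoch q q j * qPoch q (a * q / b) j * qPoch q (a * q / c) j * qPoch q (a * q / d) j) *
  ((1 - a * q ^ (2 * j)) / (1 - a) *
    (qPoch q a (2 * j) * qPoch q e j * qPoch q f j * qPoch q g j * qPoch q (q ^ n)⁻¹ j) /
    (qPoch q (a * q / e) j * qPoch q (a * q / f) j * qPoch q (a * q / g) j *
      qPoch q (a * q ^ (n + 1)) j * qPoch q (l * q) (2 * j)) * (a / l) ^ j * q ^ j)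

theorem collect_fractions (g a P Q k x y h l R S j : ℂ) :
    g / a * P / Q * k * (x / y) * (h / l * R / S * j) =
      (g * P * k * x * h * R * j) / (a * Q * y * l * S) := by
  simp only [div_eq_mul_inv, mul_inv]
  ring

theorem collect_fractions_mul (l₂ l P Q a₂ a R S x j g X Y k : ℂ) (h : a₂ ≠ 0) :
    l₂ / l * P / Q * (a₂ / a * R / S * x * j) * (g / a₂ * X / Y * k) =
      (l₂ * P * R * x * j * g * X * k) / (l * Q * a * S * Y) := by
  have h' : a₂ * a₂⁻¹ = 1 := mul_inv_cancel₀ h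
  simp only [div_eq_mul_inv, mul_inv]
  linear_combination (l₂ * l⁻¹ * P * Q⁻¹ * (a⁻¹ * R * S⁻¹ * x * j) * (g * X * Y⁻¹ * k)) * h'

theorem collect_fractions_mul_div (l₂ l P Q a₂ a R S x j X Y : ℂ) :
    l₂ / l * P / Q * (a₂ / a * R / S * x * j) * (X / Y) =
      (l₂ * P * R * x * j * a₂ * X) / (l * Q * a * S * Y) := by
  simp only [div_eq_mul_inv, mul_inv]
  ring

theorem collect_fractions_div_mul (X Y l₂ l P Q j : ℂ) :
    X / Y * (l₂ / l * P / Q * j) = (X * l₂ * P * j) / (Y * l * Q) := by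
  simp only [div_eq_mul_inv, mul_inv]
  ring

theorem div_eq_div_of_mul {N₁ D₁ N₂ D₂ T S : ℂ} (hT : T ≠ 0) (hS : S ≠ 0)
    (hN : N₁ * T = N₂ * S) (hD : D₁ * T = D₂ * S) : N₁ / D₁ = N₂ / D₂ := by
  rw [← mul_div_mul_right N₁ D₁ hT, hN, hD, mul_div_mul_right _ _ hS]

/-- With `k = j + m` and `n = j + N`, the summand of the double series factors into a part free of
`m` and a Jackson summand in `m` with base `a q^(2j)`. This makes the inner sum summable after the
exchange. -/
theorem baileyTerm_expansion_regroup {q a b c d e f g l : ℂ} (hq : q ≠ 0) (hq1 : ‖q‖ < 1)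
    (ha : a ≠ 0) (hb : b ≠ 0) (hc : c ≠ 0) (hd : d ≠ 0) (he : e ≠ 0) (hf : f ≠ 0) (hg : g ≠ 0)
    (hl : l ≠ 0) (hA : QGeneric q a) (hE : QGeneric q (a / l)) (j m N : ℕ) :
    (1 - a * q ^ (2 * (j + m))) / (1 - a) *
      (qPoch q a (j + m) * qPoch q e (j + m) * qPoch q f (j + m) * qPoch q g (j + m) *
        qPoch q (q ^ (j + N))⁻¹ (j + m)) /
      (qPoch q q (j + m) * qPoch q (a * q / e) (j + m) * qPoch q (a * q / f) (j + m) *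
        qPoch q (a * q / g) (j + m) * qPoch q (a * q ^ (j + N + 1)) (j + m)) * q ^ (j + m) *
      (qPoch q (a / l) (j + m) / qPoch q (l * q) (j + m)) *
      jacksonTerm q l (l * b / a) (l * c / a) (l * d / a) (a * q ^ (j + m)) (j + m) j =
    baileyCoeff q a b c d e f g l (j + N) j *
      jacksonTerm q (a * q ^ (2 * j)) (e * q ^ j) (f * q ^ j) (a / l) (g * q ^ j) N m := by
  have g1 : 1 - a * q ^ (2 * j) ≠ 0 := hA.one_sub_mul_pow_ne_zero _
  have hx : a / l ≠ 0 := div_ne_zero ha hl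
  have hM1 := qPoch_self_ne_zero hq1 m
  have hM2 := qPoch_self_ne_zero hq1 (j + m)
  have E1 : qPoch q a (j + m) * qPoch q (a * q ^ (j + m)) j =
      qPoch q a (2 * j) * qPoch q (a * q ^ (2 * j)) m := by
    rw [← qPoch_add, ← qPoch_add]
    congr 1; ring
  have E2 : qPoch q (l * q) (j + m) * qPoch q (l * q ^ (j + m + 1)) j =
      qPoch q (l * q) (2 * j) * qPoch q (l * q * q ^ (2 * j)) m := by
    rw [show l * q ^ (j + m + 1) = l * q * q ^ (j + m) by ring,
      ← qPoch_add, ← qPoch_add]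
    congr 1; ring
  have E3 : qPoch q (q ^ (j + m))⁻¹ j * qPoch q (a / l) (j + m) * q ^ j * qPoch q q m =
      (a / l) ^ j * qPoch q (a / l) m * qPoch q q (j + m) *
        qPoch q (l * q / (a * q ^ (j + m))) j := by
    -- These `y` and `z` make the reversed arguments `q^(-(j+m))` and `l q / (a q^(j+m))`, the
    -- numerator and denominator parameters of the expansion that still mix `j` and `m`.
    have h := pow_mul_qPoch_inv_mul_pow (y := q ^ m) (z := a / l * q ^ m / q) hq
      (pow_ne_zero _ hq) (div_ne_zero (mul_ne_zero hx (pow_ne_zero _ hq)) hq) j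
    have s1 : (q ^ m * q ^ j)⁻¹ = (q ^ (j + m))⁻¹ := by rw [pow_add, mul_comm]
    have s2 : (a / l * q ^ m / q * q ^ j)⁻¹ = l * q / (a * q ^ (j + m)) := by
      rw [pow_add]; field_simp
    have s3 : a / l * q ^ m / q * q = a / l * q ^ m := by field_simp
    rw [s1, s2, s3, div_pow, mul_pow] at h
    have s4 : qPoch q q (j + m) = qPoch q q m * qPoch q (q ^ m * q) j := by
      rw [add_comm, qPoch_add, mul_comm q]
    have s5 : qPoch q (a / l) (j + m) = qPoch q (a / l) m * qPoch q (a / l * q ^ m) j := by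
      rw [add_comm, qPoch_add]
    have hqm : (q ^ m) ^ j ≠ 0 := pow_ne_zero _ (pow_ne_zero _ hq)
    rw [s4, s5]
    apply mul_left_cancel₀ hqm
    have h' : (q ^ m) ^ j * qPoch q (q ^ (j + m))⁻¹ j * qPoch q (a / l * q ^ m) j * q ^ j =
        (a / l) ^ j * (q ^ m) ^ j * qPoch q (l * q / (a * q ^ (j + m))) j *
          qPoch q (q ^ m * q) j := by
      rw [h]; field_simp
    linear_combination qPoch q (a / l) m * qPoch q q m * h'
  have e1 : a * q ^ (2 * j) * q / (e * q ^ j) = a * q / e * q ^ j := by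
    rw [two_mul, pow_add]; field_simp
  have e2 : a * q ^ (2 * j) * q / (f * q ^ j) = a * q / f * q ^ j := by
    rw [two_mul, pow_add]; field_simp
  have e3 : a * q ^ (2 * j) * q / (g * q ^ j) = a * q / g * q ^ j := by
    rw [two_mul, pow_add]; field_simp
  have e4 : a * q ^ (2 * j) * q / (a / l) = l * q * q ^ (2 * j) := by field_simp
  have e5 : a * q ^ (2 * j) * q ^ (N + 1) = a * q ^ (j + N + 1) * q ^ j := by ring
  have e6 : (q ^ (j + N))⁻¹ * q ^ j = (q ^ N)⁻¹ := by rw [pow_add]; field_simp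
  have f1 : l * q / (l * b / a) = a * q / b := by field_simp
  have f2 : l * q / (l * c / a) = a * q / c := by field_simp
  have f3 : l * q / (l * d / a) = a * q / d := by field_simp
  have f4 : a * q ^ (2 * j) * q ^ (2 * m) = a * q ^ (2 * (j + m)) := by ring
  simp only [jacksonTerm, baileyCoeff, e1, e2, e3, e4, e5, f1, f2, f3, f4]
  rw [qPoch_add q e, qPoch_add q f, qPoch_add q g, qPoch_add q (q ^ (j + N))⁻¹, e6,
    qPoch_add q (a * q / e), qPoch_add q (a * q / f), qPoch_add q (a * q / g),
    qPoch_add q (a * q ^ (j + N + 1))]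
  have hZ : qPoch q (l * q / (a * q ^ (j + m))) j ≠ 0 := by
    refine QGeneric.qPoch_ne_zero (hE.inv.of_eq hq (1 - (j + m : ℕ)) ?_) j
    rw [zpow_sub₀ hq, zpow_one, zpow_natCast]
    field_simp
  rw [collect_fractions, collect_fractions_mul _ _ _ _ _ _ _ _ _ _ _ _ _ _ g1]
  refine div_eq_div_of_mul hM1 (mul_ne_zero hM2 hZ) ?_ ?_
  · clear * - E1 E3
    generalize qPoch q (l * q / (a * q ^ (j + m))) j = Z at *
    generalize qPoch q a (j + m) = y1 at *
    generalize qPoch q (a * q ^ (j + m)) j = y2 at *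
    generalize qPoch q (q ^ (j + m))⁻¹ j = y3 at *
    generalize qPoch q (a / l) (j + m) = y4 at *
    generalize qPoch q q m = y5 at *
    generalize qPoch q q (j + m) = y6 at *
    generalize qPoch q a (2 * j) = y7 at *
    generalize qPoch q (a * q ^ (2 * j)) m = y8 at *
    generalize qPoch q (a / l) m = y9 at *
    generalize (a / l) ^ j = z0 at *
    generalize 1 - a * q ^ (2 * (j + m)) = z1
    generalize 1 - l * q ^ (2 * j) = z2
    generalize qPoch q l j = z3
    generalize qPoch q (l * b / a) j = z4
    generalize qPoch q (l * c / a) j = z5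
    generalize qPoch q (l * d / a) j = z6
    linear_combination
      (z1 * qPoch q e j * qPoch q (e * q ^ j) m * qPoch q f j * qPoch q (f * q ^ j) m *
        qPoch q g j * qPoch q (g * q ^ j) m * qPoch q (q ^ (j + N))⁻¹ j * qPoch q (q ^ N)⁻¹ m *
        z2 * z3 * z4 * z5 * z6 * q ^ j * q ^ m) *
      (y1 * y2 * E3 + z0 * y9 * y6 * Z * E1)
  · clear * - E2
    generalize qPoch q (l * q / (a * q ^ (j + m))) j = Z at *
    generalize qPoch q (l * q) (j + m) = y1 at *
    generalize qPoch q (l * q ^ (j + m + 1)) j = y2 at *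
    generalize qPoch q (l * q) (2 * j) = y3 at *
    generalize qPoch q (l * q * q ^ (2 * j)) m = y4 at *
    generalize 1 - a = z1
    generalize 1 - l = z2
    generalize qPoch q (a * q / b) j = z3
    generalize qPoch q (a * q / c) j = z4
    generalize qPoch q (a * q / d) j = z5
    generalize qPoch q (a * q / e) j = z6
    generalize qPoch q (a * q / f) j = z7
    generalize qPoch q (a * q / g) j = z8
    generalize qPoch q (a * q / e * q ^ j) m = w6
    generalize qPoch q (a * q / f * q ^ j) m = w7
    generalize qPoch q (a * q / g * q ^ j) m = w8
    generalize qPoch q (a * q ^ (j + N + 1)) j = x1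
    generalize qPoch q (a * q ^ (j + N + 1) * q ^ j) m = x2
    generalize qPoch q q j = x3
    generalize qPoch q q m = x4
    generalize qPoch q q (j + m) = x5
    linear_combination (z1 * x5 * z6 * w6 * z7 * w7 * z8 * w8 * x1 * x2 * z2 * x3 * z3 * z4 * z5 *
      Z * x4) * E2

/-- Once the inner sum is evaluated by Jackson's formula, what remains is the prefactor of Bailey's
transformation times the summand with base `l`. -/
theorem baileyCoeff_mul_inner {q a b c d e f g l : ℂ} (hq : q ≠ 0)
    (ha : a ≠ 0) (hb : b ≠ 0) (hc : c ≠ 0) (hd : d ≠ 0) (he : e ≠ 0) (hf : f ≠ 0) (hg : g ≠ 0)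
    (hl : l ≠ 0) (hA : QGeneric q a)
    (hG : QGeneric q (a / g)) (hLE : QGeneric q (l / e))
    (hLF : QGeneric q (l / f)) (hLG : QGeneric q (l / g)) (j N : ℕ)
    (hbal : e * f * g = a * l * q ^ (j + N + 1)) :
    baileyCoeff q a b c d e f g l (j + N) j *
      (qPoch q (a * q ^ (2 * j) * q) N * qPoch q (a * q / (e * f)) N *
        qPoch q (l * q / e * q ^ j) N * qPoch q (l * q / f * q ^ j) N /
      (qPoch q (a * q / e * q ^ j) N * qPoch q (a * q / f * q ^ j) N *
        qPoch q (l * q * q ^ (2 * j)) N * qPoch q (l * q / (e * f)) N)) =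
    qPoch q (a * q) (j + N) * qPoch q (a * q / (e * f)) (j + N) * qPoch q (l * q / e) (j + N) *
        qPoch q (l * q / f) (j + N) /
      (qPoch q (a * q / e) (j + N) * qPoch q (a * q / f) (j + N) * qPoch q (l * q) (j + N) *
        qPoch q (l * q / (e * f)) (j + N)) *
      baileyTerm q l (l * b / a) (l * c / a) (l * d / a) e f g (j + N) j := by
  have f1 : l * q / (l * b / a) = a * q / b := by field_simp
  have f2 : l * q / (l * c / a) = a * q / c := by field_simp
  have f3 : l * q / (l * d / a) = a * q / d := by field_simp
  have E1 : qPoch q a (2 * j) * (1 - a * q ^ (2 * j)) * qPoch q (a * q ^ (2 * j) * q) N =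
      (1 - a) * qPoch q (a * q) (j + N) * qPoch q (a * q ^ (j + N + 1)) j := by
    rw [mul_assoc, ← qPoch_succ', ← qPoch_add,
      show a * q ^ (j + N + 1) = a * q * q ^ (j + N) by ring, mul_assoc, ← qPoch_add,
      ← qPoch_succ']
    congr 1; ring
  have E2 : qPoch q (l * q) (2 * j) * qPoch q (l * q * q ^ (2 * j)) N =
      qPoch q (l * q) (j + N) * qPoch q (l * q ^ (j + N + 1)) j := by
    rw [← qPoch_add, show l * q ^ (j + N + 1) = l * q * q ^ (j + N) by ring, ← qPoch_add]
    congr 1; ring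
  -- By balancing, the tails of `(aq/(ef))_{j+N}` and `(lq/(ef))_{j+N}` are reversed factorials of
  -- `l / g` and `a / g`; this is how the factorials `(lq/g)_j` and `(aq/g)_j` get exchanged.
  have s1 : (l / g * q ^ j)⁻¹ = a * q / (e * f) * q ^ N := by
    apply inv_eq_of_mul_eq_one_left
    field_simp
    linear_combination -hbal
  have s2 : (a / g * q ^ j)⁻¹ = l * q / (e * f) * q ^ N := by
    apply inv_eq_of_mul_eq_one_left
    field_simp
    linear_combination -hbal
  have E3 : (a / l) ^ j * qPoch q (a * q / (e * f)) N * qPoch q (l * q / g) j *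
        qPoch q (l * q / (e * f)) (j + N) =
      qPoch q (a * q / (e * f)) (j + N) * qPoch q (a * q / g) j *
        qPoch q (l * q / (e * f)) N := by
    have h := pow_mul_qPoch_inv_mul_pow (y := l / g) (z := a / g) hq (div_ne_zero hl hg)
      (div_ne_zero ha hg) j
    rw [s1, s2, show l / g * q = l * q / g by ring, show a / g * q = a * q / g by ring] at h
    rw [add_comm j N, qPoch_add, qPoch_add]
    have hlg : (l / g) ^ j ≠ 0 := pow_ne_zero _ (div_ne_zero hl hg)
    apply mul_left_cancel₀ hlg
    have e1 : (l / g) ^ j * (a / l) ^ j = (a / g) ^ j := by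
      rw [← mul_pow]; congr 1; field_simp
    linear_combination (-qPoch q (a * q / (e * f)) N * qPoch q (l * q / (e * f)) N) * h +
      qPoch q (a * q / (e * f)) N * qPoch q (l * q / g) j * (qPoch q (l * q / (e * f)) N *
        qPoch q (l * q / (e * f) * q ^ N) j) * e1
  have n1 := hA.one_sub_ne_zero
  have n2 : qPoch q (l * q / (e * f)) (j + N) ≠ 0 := by
    refine (hG.inv.of_eq hq (-(j + N : ℕ)) ?_).qPoch_ne_zero _
    rw [zpow_neg, zpow_natCast, inv_div]
    field_simp
    linear_combination -hbal
  have n3 : qPoch q (l * q / g) j ≠ 0 := (hLG.of_eq hq 1 (by rw [zpow_one]; ring)).qPoch_ne_zero _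
  have n4 : qPoch q (l * q / (e * f)) N ≠ 0 := by
    rw [add_comm, qPoch_add] at n2
    exact left_ne_zero_of_mul n2
  have n5 : qPoch q (a * q / g) j ≠ 0 := (hG.of_eq hq 1 (by rw [zpow_one]; ring)).qPoch_ne_zero _
  have n6 : qPoch q (l * q / e) j ≠ 0 := (hLE.of_eq hq 1 (by rw [zpow_one]; ring)).qPoch_ne_zero _
  have n7 : qPoch q (l * q / f) j ≠ 0 := (hLF.of_eq hq 1 (by rw [zpow_one]; ring)).qPoch_ne_zero _
  have n8 : qPoch q (a * q ^ (j + N + 1)) j ≠ 0 :=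
    (hA.of_eq hq (j + N + 1 : ℕ) (by rw [zpow_natCast])).qPoch_ne_zero _
  simp only [baileyCoeff, baileyTerm, f1, f2, f3]
  rw [qPoch_add q (l * q / e), qPoch_add q (l * q / f), qPoch_add q (a * q / e),
    qPoch_add q (a * q / f)]
  rw [collect_fractions_mul_div, collect_fractions_div_mul]
  refine div_eq_div_of_mul (mul_ne_zero (mul_ne_zero (mul_ne_zero n6 n7) n3) n2)
    (mul_ne_zero (mul_ne_zero (mul_ne_zero n1 n5) n4) n8) ?_ ?_
  · clear * - E1 E3
    generalize qPoch q (a * q / (e * f)) (j + N) = z1 at *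
    generalize qPoch q (a * q / (e * f)) N = z2 at *
    generalize qPoch q (l * q / (e * f)) (j + N) = z3 at *
    generalize qPoch q (l * q / (e * f)) N = z4 at *
    generalize qPoch q (l * q / g) j = z5 at *
    generalize qPoch q (a * q / g) j = z6 at *
    generalize (a / l) ^ j = z7 at *
    generalize qPoch q a (2 * j) = y1 at *
    generalize 1 - a * q ^ (2 * j) = y2 at *
    generalize qPoch q (a * q ^ (2 * j) * q) N = y3 at *
    generalize qPoch q (a * q) (j + N) = y4 at *
    generalize qPoch q (a * q ^ (j + N + 1)) j = y5 at *
    generalize 1 - a = y6 at *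
    generalize qPoch q (l * b / a) j = x1
    generalize qPoch q (l * c / a) j = x2
    generalize qPoch q (l * d / a) j = x3
    generalize 1 - l * q ^ (2 * j) = x4
    generalize qPoch q (l * q / e) j = x5
    generalize qPoch q (l * q / f) j = x6
    generalize qPoch q (l * q / e * q ^ j) N = x7
    generalize qPoch q (l * q / f * q ^ j) N = x8
    linear_combination (x4 * qPoch q l j * x1 * x2 * x3 * qPoch q e j * qPoch q f j *
      qPoch q g j * qPoch q (q ^ (j + N))⁻¹ j * q ^ j * x5 * x6 * x7 * x8) *
      (y1 * y2 * y3 * E3 + z1 * z6 * z4 * E1)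
  · clear * - E2
    generalize qPoch q (l * q) (2 * j) = y1 at *
    generalize qPoch q (l * q * q ^ (2 * j)) N = y2 at *
    generalize qPoch q (l * q) (j + N) = y3 at *
    generalize qPoch q (l * q ^ (j + N + 1)) j = y4 at *
    generalize qPoch q (l * q / (e * f)) (j + N) = z3
    generalize qPoch q (l * q / (e * f)) N = z4
    generalize qPoch q (l * q / g) j = z5
    generalize qPoch q (l * q / e) j = x5
    generalize qPoch q (l * q / f) j = x6
    generalize qPoch q (a * q / b) j = x1
    generalize qPoch q (a * q / c) j = x2
    generalize qPoch q (a * q / d) j = x3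
    generalize qPoch q (a * q / e) j = w1
    generalize qPoch q (a * q / f) j = w2
    generalize qPoch q (a * q / g) j = w3
    generalize qPoch q (a * q / e * q ^ j) N = w4
    generalize qPoch q (a * q / f * q ^ j) N = w5
    generalize qPoch q (a * q ^ (j + N + 1)) j = w6
    generalize 1 - a = v1
    generalize 1 - l = v2
    linear_combination (v2 * qPoch q q j * x1 * x2 * x3 * v1 * w1 * w2 * w3 * w4 * w5 * w6 * z4 *
      x5 * x6 * z5 * z3) * E2

/-- Bailey's transformation between terminating balanced very-well-poised `₁₀φ₉` series. -/
theorem bailey_transformation {q a b c d e f g l : ℂ} {n : ℕ} (hq : q ≠ 0) (hq1 : ‖q‖ < 1)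
    (ha : a ≠ 0) (hb : b ≠ 0) (hc : c ≠ 0) (hd : d ≠ 0) (he : e ≠ 0) (hf : f ≠ 0) (hg : g ≠ 0)
    (hl : l = a ^ 2 * q / (b * c * d)) (hbal : e * f * g = a * l * q ^ (n + 1))
    (hA : QGeneric q a) (hL : QGeneric q l) (hAL : QGeneric q (a / l))
    (hB : QGeneric q (a / b)) (hC : QGeneric q (a / c)) (hD : QGeneric q (a / d))
    (hE : QGeneric q (a / e)) (hF : QGeneric q (a / f)) (hG : QGeneric q (a / g))
    (hLE : QGeneric q (l / e)) (hLF : QGeneric q (l / f)) (hLG : QGeneric q (l / g)) :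
    ∑ k ∈ range (n + 1), baileyTerm q a b c d e f g n k =
      qPoch q (a * q) n * qPoch q (a * q / (e * f)) n * qPoch q (l * q / e) n *
        qPoch q (l * q / f) n /
      (qPoch q (a * q / e) n * qPoch q (a * q / f) n * qPoch q (l * q) n *
        qPoch q (l * q / (e * f)) n) *
      ∑ k ∈ range (n + 1), baileyTerm q l (l * b / a) (l * c / a) (l * d / a) e f g n k := by
  have hl0 : l ≠ 0 := by rw [hl]; positivity
  set H : ℕ → ℕ → ℂ := fun k j => (1 - a * q ^ (2 * k)) / (1 - a) *
      (qPoch q a k * qPoch q e k * qPoch q f k * qPoch q g k * qPoch q (q ^ n)⁻¹ k) /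
      (qPoch q q k * qPoch q (a * q / e) k * qPoch q (a * q / f) k *
        qPoch q (a * q / g) k * qPoch q (a * q ^ (n + 1)) k) * q ^ k *
      (qPoch q (a / l) k / qPoch q (l * q) k) *
      jacksonTerm q l (l * b / a) (l * c / a) (l * d / a) (a * q ^ k) k j with hH
  -- The index `k` is written `j + (k - j)` to match the form required by `sum_range_diag_flip`.
  have h1 : ∀ k, baileyTerm q a b c d e f g n k =
      ∑ j ∈ range (k + 1), H (j + (k - j)) j := by
    intro k
    have h := qPoch_triple_expansion hq hq1 ha hb hc hd hl hL hB hC hD hAL k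
    have : ∑ j ∈ range (k + 1), H (j + (k - j)) j = ∑ j ∈ range (k + 1), H k j :=
      sum_congr rfl fun j hj => by
        rw [Nat.add_sub_cancel' (Nat.lt_succ_iff.1 (mem_range.1 hj))]
    rw [this]
    simp only [hH]
    rw [← mul_sum, mul_assoc, ← h, baileyTerm]
    simp only [div_eq_mul_inv, mul_inv]
    ring
  simp only [h1]
  rw [sum_range_diag_flip (n + 1) fun j m => H (j + m) j, mul_sum]
  refine sum_congr rfl fun j hj => ?_
  obtain ⟨N, rfl⟩ := Nat.exists_eq_add_of_le (Nat.lt_succ_iff.1 (mem_range.1 hj))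
  rw [← baileyCoeff_mul_inner hq ha hb hc hd he hf hg hl0 hA hG hLE hLF hLG j N hbal,
    show j + N + 1 - j = N + 1 by omega]
  have h2 : ∀ m, H (j + m) j = baileyCoeff q a b c d e f g l (j + N) j *
      jacksonTerm q (a * q ^ (2 * j)) (e * q ^ j) (f * q ^ j) (a / l) (g * q ^ j) N m :=
    fun m => baileyTerm_expansion_regroup hq hq1 ha hb hc hd he hf hg hl0 hA hAL j m N
  simp only [h2]
  rw [← mul_sum]
  congr 1
  have hqj : q ^ j ≠ 0 := pow_ne_zero _ hq
  have hx : a / l ≠ 0 := div_ne_zero ha hl0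
  have e1 : a * q ^ (2 * j) / (e * q ^ j) = a / e * q ^ (j : ℤ) := by
    rw [zpow_natCast, two_mul, pow_add]; field_simp
  have e2 : a * q ^ (2 * j) / (f * q ^ j) = a / f * q ^ (j : ℤ) := by
    rw [zpow_natCast, two_mul, pow_add]; field_simp
  have e3 : a * q ^ (2 * j) / (a / l) = l * q ^ ((2 * j : ℕ) : ℤ) := by
    rw [zpow_natCast]; field_simp
  have e4 : a * q ^ (2 * j) / (e * q ^ j * (f * q ^ j) * (a / l)) =
      (a / g)⁻¹ * q ^ (-((j + N + 1 : ℕ) : ℤ)) := by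
    rw [zpow_neg, zpow_natCast, inv_div, two_mul, pow_add q j j]
    field_simp
    linear_combination -hbal
  have J := jackson_sum hq hq1 (mul_ne_zero ha (pow_ne_zero (2 * j) hq)) (mul_ne_zero he hqj)
    (mul_ne_zero hf hqj) hx (hA.of_eq hq (2 * j : ℕ) (by rw [zpow_natCast]))
    (hE.of_eq hq _ e1) (hF.of_eq hq _ e2) (hL.of_eq hq _ e3) (hG.inv.of_eq hq _ e4) N
  -- Balancing of the `₁₀φ₉` series is what makes the inner `₈φ₇` series balanced: its last
  -- parameter must be `g q^j`.
  have f0 : (a * q ^ (2 * j)) ^ 2 * q ^ (N + 1) / (e * q ^ j * (f * q ^ j) * (a / l)) =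
      g * q ^ j := by
    rw [div_eq_iff (by positivity)]
    field_simp
    linear_combination (-(q ^ j) ^ 3) * hbal
  have f1 : a * q ^ (2 * j) * q / (e * q ^ j) = a * q / e * q ^ j := by
    rw [two_mul, pow_add]; field_simp
  have f2 : a * q ^ (2 * j) * q / (f * q ^ j) = a * q / f * q ^ j := by
    rw [two_mul, pow_add]; field_simp
  have f3 : a * q ^ (2 * j) * q / (a / l) = l * q * q ^ (2 * j) := by field_simp
  have f4 : a * q ^ (2 * j) * q / (e * q ^ j * (f * q ^ j)) = a * q / (e * f) := by
    rw [two_mul, pow_add]; field_simp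
  have f5 : a * q ^ (2 * j) * q / (e * q ^ j * (a / l)) = l * q / e * q ^ j := by
    rw [two_mul, pow_add]; field_simp
  have f6 : a * q ^ (2 * j) * q / (f * q ^ j * (a / l)) = l * q / f * q ^ j := by
    rw [two_mul, pow_add]; field_simp
  have f7 : a * q ^ (2 * j) * q / (e * q ^ j * (f * q ^ j) * (a / l)) = l * q / (e * f) := by
    rw [two_mul, pow_add]; field_simp
  rw [f0, f1, f2, f3, f4, f5, f6, f7] at J
  exact J

/-! ### The type `C` Vandermonde product as a determinant -/

/-- `∏_{l<s} (1 - b q^l z) (z - b q^l / a)`: up to the factor `z ^ s`, a polynomial of degree `s` in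
`z⁻¹ + a z`. -/
noncomputable def shiftPoly (q a b : ℂ) (s : ℕ) (z : ℂ) : ℂ :=
  ∏ l ∈ range s, (1 - b * q ^ l * z) * (z - b * q ^ l / a)

/-- At `z = q^k` the `l`-th factor, divided by its value at `z = 1`, shifts `b q^l` to `b q^(l+1)`
in the numerator factorial and correspondingly in `(aq/b)_k`. Hence the whole product shifts `b` to
`b q^s`. -/
theorem qPoch_mul_shiftPoly_one {q a b : ℂ} (hq : q ≠ 0) (ha : a ≠ 0) (hb : b ≠ 0) (s k : ℕ) :
    qPoch q (b * q ^ s) k * qPoch q (a * q / b) k * shiftPoly q a b s 1 =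
      shiftPoly q a b s (q ^ k) * qPoch q b k * qPoch q (a * q / (b * q ^ s)) k := by
  induction s with
  | zero => simp [shiftPoly]
  | succ s ih =>
    have hqs : q ^ s ≠ 0 := pow_ne_zero _ hq
    have h1 : ∀ x : ℂ, (1 - x) * qPoch q (x * q) k = qPoch q x k * (1 - x * q ^ k) := fun x => by
      rw [← qPoch_succ', qPoch_succ]
    have e1 := h1 (b * q ^ s)
    have e2 := h1 (a / (b * q ^ s))
    have e3 : a * q / (b * q ^ (s + 1)) = a / (b * q ^ s) := by rw [pow_succ]; field_simp
    have e4 : a / (b * q ^ s) * q = a * q / (b * q ^ s) := by ring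
    have e5 : b * q ^ s * q = b * q ^ (s + 1) := by ring
    rw [e4] at e2
    rw [e5] at e1
    rw [e3]
    have s1 : ∀ z, shiftPoly q a b (s + 1) z =
        shiftPoly q a b s z * ((1 - b * q ^ s * z) * (z - b * q ^ s / a)) := fun z => by
      rw [shiftPoly, prod_range_succ, ← shiftPoly]
    rw [s1, s1]
    have s2 : ∀ z : ℂ, z - b * q ^ s / a = -(b * q ^ s / a) * (1 - a / (b * q ^ s) * z) := by
      intro z; field_simp; ring
    rw [s2, s2, mul_one, mul_one]
    generalize qPoch q (a / (b * q ^ s)) k = u at *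
    generalize qPoch q (a * q / (b * q ^ s)) k = u' at *
    generalize qPoch q (b * q ^ (s + 1)) k = v at *
    generalize qPoch q (b * q ^ s) k = v' at *
    generalize b * q ^ s = x at *
    linear_combination (shiftPoly q a b s 1 * qPoch q (a * q / b) k * (-(x / a)) * (1 - a / x)) * e1
      + (-(x / a)) * (1 - x * q ^ k) * (1 - a / x) * ih
      - (-(x / a)) * (1 - x * q ^ k) * shiftPoly q a b s (q ^ k) * qPoch q b k * e2 * (-1)

-- With `β = b q^l`, one has `(1 - β z)(z - β/a) = z (1 + β²/a - (β/a)(1 + a z²)/z)`, linear in the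
-- invariant of `z ↦ 1/(a z)`.
open Polynomial in
theorem exists_shiftPoly_eq_eval (q b : ℂ) {a : ℂ} (ha : a ≠ 0) (s : ℕ) :
    ∃ p : ℂ[X], p.natDegree ≤ s ∧
      ∀ z, z ≠ 0 → shiftPoly q a b s z = z ^ s * p.eval ((1 + a * z ^ 2) / z) := by
  refine ⟨∏ l ∈ range s, (C (1 + b ^ 2 * q ^ (2 * l) / a) - C (b * q ^ l / a) * X), ?_, ?_⟩
  · refine (natDegree_prod_le _ _).trans ?_
    refine (sum_le_sum (g := fun _ => 1) fun l _ => ?_).trans (by simp)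
    compute_degree
  · intro z hz
    rw [shiftPoly, eval_prod, ← card_range s, ← prod_const, card_range, ← prod_mul_distrib]
    refine prod_congr rfl fun l _ => ?_
    simp only [eval_sub, eval_C, eval_mul, eval_X]
    field_simp
    ring

open Polynomial in
/-- The determinant of the matrix of values of a basis of polynomials is a constant multiple of the
Vandermonde determinant of type `C`. -/
theorem exists_det_shiftPoly_eq (q b c : ℂ) {a : ℂ} (ha : a ≠ 0) (R : ℕ) :
    ∃ D : ℂ, ∀ z : Fin (R + 1) → ℂ, (∀ i, z i ≠ 0) →
      (Matrix.of fun i s : Fin (R + 1) =>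
        shiftPoly q a b s (z i) * shiftPoly q a c (R - s) (z i)).det =
      D * ∏ i, ∏ j ∈ Ioi i, (z i - z j) * (1 - a * (z i * z j)) := by
  choose p hp hpe using exists_shiftPoly_eq_eval q b ha
  choose p' hp' hpe' using exists_shiftPoly_eq_eval q c ha
  -- The products have degree at most `R`, so their `R + 1` coefficients form a square matrix, and
  -- the value matrix is a Vandermonde matrix times it.
  refine ⟨(Matrix.of fun j s : Fin (R + 1) => (p s * p' (R - s)).coeff j).det, fun z hz => ?_⟩
  -- The homogeneous Vandermonde at the points `(1 + a z² : z)` avoids division by `z`: its factors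
  -- are `(1 + a z_j²) z_i - (1 + a z_i²) z_j`.
  have h1 : ∏ i, ∏ j ∈ Ioi i, (z i - z j) * (1 - a * (z i * z j)) =
      (Matrix.projVandermonde (fun i => 1 + a * z i ^ 2) z).det := by
    rw [Matrix.det_projVandermonde]
    refine prod_congr rfl fun i _ => prod_congr rfl fun j _ => ?_
    ring
  rw [h1, mul_comm, ← Matrix.det_mul]
  congr 1
  ext i s
  rw [Matrix.mul_apply]
  simp only [Matrix.of_apply, Matrix.projVandermonde_apply]
  have hs : (s : ℕ) ≤ R := Nat.lt_succ_iff.1 s.2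
  rw [hpe _ _ (hz i), hpe' _ _ (hz i), mul_mul_mul_comm, ← pow_add, ← eval_mul,
    Nat.add_sub_cancel' hs, eval_eq_sum_range' (n := R + 1), mul_sum, ← Fin.sum_univ_eq_sum_range
      fun j => z i ^ R * ((p s * p' (R - s)).coeff j * ((1 + a * z i ^ 2) / z i) ^ j)]
  · refine sum_congr rfl fun j _ => ?_
    have hj : (Fin.rev j : ℕ) = R - j := by rw [Fin.val_rev]; omega
    have hj' : R = (R - j) + j := (Nat.sub_add_cancel (Nat.lt_succ_iff.1 j.2)).symm
    have e : z i ^ R = z i ^ (R - j : ℕ) * z i ^ (j : ℕ) := by rw [← pow_add, ← hj']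
    have hzj : z i ^ (j : ℕ) ≠ 0 := pow_ne_zero _ (hz i)
    rw [hj, e, div_pow]
    field_simp
  · refine lt_of_le_of_lt (natDegree_mul_le.trans (add_le_add (hp _) (hp' _))) ?_
    omega

/-- The constant does not depend on `z`, so it can be read off at one point where the matrix is
triangular and the Vandermonde product is nonzero. -/
theorem det_shiftPoly_const_eq {q a b c D : ℂ} (hq : q ≠ 0) (hq1 : ‖q‖ < 1) (ha : a ≠ 0)
    (hc : c ≠ 0) (hac : QGeneric q (a / c ^ 2)) {R : ℕ}
    (hD : ∀ z : Fin (R + 1) → ℂ, (∀ i, z i ≠ 0) →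
      (Matrix.of fun i s : Fin (R + 1) =>
        shiftPoly q a b s (z i) * shiftPoly q a c (R - s) (z i)).det =
      D * ∏ i, ∏ j ∈ Ioi i, (z i - z j) * (1 - a * (z i * z j))) :
    D = ∏ i : Fin (R + 1), ∏ l ∈ range i, ((1 - b / c * (q ^ l / q ^ (R - i : ℕ))) *
      (1 - b * c / a * (q ^ l * q ^ (R - i : ℕ))) * (c / a * q ^ (R - i : ℕ))) := by
  -- At this point `1 - c q^l z_i` vanishes for `l = R - i`, and that factor occurs in column `s`
  -- exactly when `s < i`.
  set z : Fin (R + 1) → ℂ := fun i => (c * q ^ (R - i : ℕ))⁻¹ with hz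
  have hz0 : ∀ i, z i ≠ 0 := fun i => inv_ne_zero (mul_ne_zero hc (pow_ne_zero _ hq))
  have hV : ∏ i, ∏ j ∈ Ioi i, (z i - z j) * (1 - a * (z i * z j)) ≠ 0 := by
    refine prod_ne_zero_iff.2 fun i _ => prod_ne_zero_iff.2 fun j hj => mul_ne_zero ?_ ?_
    · have hij : (i : ℕ) < j := Fin.lt_def.1 (mem_Ioi.1 hj)
      intro h
      have h2 : c * q ^ (R - i : ℕ) = c * q ^ (R - j : ℕ) := inv_injective (sub_eq_zero.1 h)
      have h3 := mul_left_cancel₀ hc h2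
      have hjR : (j : ℕ) < R + 1 := j.2
      rw [show R - (i : ℕ) = (R - j) + (j - i) by omega, pow_add] at h3
      have h4 : q ^ (j - i : ℕ) = 1 := by
        apply mul_left_cancel₀ (pow_ne_zero (R - j : ℕ) hq)
        rw [h3, mul_one]
      exact one_sub_pow_ne_zero hq1 (by omega : (j - i : ℕ) ≠ 0) (by rw [h4, sub_self])
    · intro h
      apply hac (-((R - i + (R - j) : ℕ) : ℤ))
      rw [zpow_neg, zpow_natCast, pow_add]
      have h2 := sub_eq_zero.1 h
      rw [h2]
      simp only [hz]
      field_simp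
  have h := hD z hz0
  rw [Matrix.det_of_isUpperTriangular] at h
  · apply mul_right_cancel₀ hV
    rw [← h]
    simp only [Matrix.of_apply]
    -- Under `j = R - l` one has `c q^l = 1 / z_j`, so each diagonal factor coming from `c` is a
    -- Vandermonde factor divided by `a z_j²`.
    have h1 : ∀ i : Fin (R + 1), shiftPoly q a c (R - i) (z i) =
        ∏ j ∈ Ioi i, (1 / (a * z j ^ 2)) * ((z i - z j) * (1 - a * (z i * z j))) := by
      intro i
      rw [shiftPoly]
      refine prod_bij' (fun l _ => (⟨R - l, by omega⟩ : Fin (R + 1))) (fun j _ => R - j)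
        ?_ ?_ ?_ ?_ ?_
      · intro l hl
        have := mem_range.1 hl
        rw [mem_Ioi, Fin.lt_def]
        simp only
        omega
      · intro j hj
        have := Fin.lt_def.1 (mem_Ioi.1 hj)
        have := j.2
        rw [mem_range]
        omega
      · intro l hl
        have := mem_range.1 hl
        simp only
        omega
      · intro j hj
        have := j.2
        ext
        simp only
        omega
      · intro l hl
        have := mem_range.1 hl
        have e : R - (R - l) = l := by omega
        simp only [hz, e]
        field_simp
        ring
    -- Each `j` has `j` predecessors, so these scalars can be distributed over the factors of the
    -- `b`-part of the diagonal.
    have h2 : ∏ i : Fin (R + 1), ∏ j ∈ Ioi i, (1 / (a * z j ^ 2)) =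
        ∏ j : Fin (R + 1), ∏ _l ∈ range j, (1 / (a * z j ^ 2)) := by
      rw [prod_comm' (t' := univ) (s' := fun j => Iio j) (by simp)]
      refine prod_congr rfl fun j _ => ?_
      rw [prod_const, prod_const, Fin.card_Iio, card_range]
    have h3 : ∏ i, ∏ j ∈ Ioi i, (1 / (a * z j ^ 2)) * ((z i - z j) * (1 - a * (z i * z j))) =
        (∏ i : Fin (R + 1), ∏ j ∈ Ioi i, (1 / (a * z j ^ 2))) *
          ∏ i, ∏ j ∈ Ioi i, (z i - z j) * (1 - a * (z i * z j)) := by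
      rw [← prod_mul_distrib]
      exact prod_congr rfl fun i _ => prod_mul_distrib
    simp only [h1]
    rw [prod_mul_distrib, h3, h2, ← mul_assoc, ← prod_mul_distrib]
    congr 1
    refine prod_congr rfl fun i _ => ?_
    rw [shiftPoly, ← prod_mul_distrib]
    refine prod_congr rfl fun l _ => ?_
    have hR : q ^ (R - i : ℕ) ≠ 0 := pow_ne_zero _ hq
    simp only [hz]
    field_simp
  · intro i s his
    have his' : (s : ℕ) < i := Fin.lt_def.1 his
    have := i.2
    rw [Matrix.of_apply]
    refine mul_eq_zero_of_right _ (prod_eq_zero (mem_range.2 (by omega : R - (i : ℕ) < R - s)) ?_)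
    refine mul_eq_zero_of_left ?_ _
    rw [mul_inv_cancel₀ (mul_ne_zero hc (pow_ne_zero _ hq)), sub_self]

/-! ### The `C_r` series as a determinant of single series -/

/-- Multilinearity in the rows; each row carries its own summation index. -/
theorem det_sum_row {r : ℕ} (n : Fin r → ℕ) (A : Fin r → Fin r → ℕ → ℂ) :
    (Matrix.of fun i s => ∑ k ∈ range (n i + 1), A i s k).det =
      ∑ k ∈ multiBox n, (Matrix.of fun i s => A i s (k i)).det := by
  simp only [← Matrix.det_transpose (Matrix.of _), Matrix.det_apply', Matrix.transpose_apply,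
    Matrix.of_apply]
  rw [sum_comm]
  refine sum_congr rfl fun σ _ => ?_
  rw [prod_univ_sum, mul_sum, multiBox]

/-- The terminating very-well-poised `₁₀φ₉` series of type `C_r` with one pair of parameters
`e q^{n_i}`, `q^{-n_i}` depending on the index. -/
noncomputable def crSum (q a b c d e f g : ℂ) {r : ℕ} (n : Fin r → ℕ) : ℂ :=
  ∑ k ∈ multiBox n, crFactor q a k *
    ∏ i, baileyTerm q a b c d (e * q ^ n i) f g (n i) (k i)

theorem baileyTerm_mul_shiftPoly {q a b c : ℂ} (d e f g : ℂ) (hq : q ≠ 0) (ha : a ≠ 0) (hb : b ≠ 0)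
    (hc : c ≠ 0) (hB : QGeneric q (a / b)) (hC : QGeneric q (a / c)) (n k s t : ℕ) :
    baileyTerm q a b c d e f g n k * (shiftPoly q a b s (q ^ k) * shiftPoly q a c t (q ^ k)) =
      shiftPoly q a b s 1 * shiftPoly q a c t 1 *
        baileyTerm q a (b * q ^ s) (c * q ^ t) d e f g n k := by
  have gen : ∀ {x : ℂ} (u : ℕ), x ≠ 0 → QGeneric q (a / x) →
      qPoch q (a * q / (x * q ^ u)) k ≠ 0 := by
    intro x u hx h
    refine (h.of_eq hq (1 - u) ?_).qPoch_ne_zero k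
    rw [zpow_sub₀ hq, zpow_one, zpow_natCast]
    field_simp
  have e1 : shiftPoly q a b s (q ^ k) * qPoch q b k / qPoch q (a * q / b) k =
      shiftPoly q a b s 1 * qPoch q (b * q ^ s) k / qPoch q (a * q / (b * q ^ s)) k := by
    have h0 := gen 0 hb hB
    rw [pow_zero, mul_one] at h0
    rw [div_eq_div_iff h0 (gen s hb hB), ← qPoch_mul_shiftPoly_one hq ha hb]
    ring
  have e2 : shiftPoly q a c t (q ^ k) * qPoch q c k / qPoch q (a * q / c) k =
      shiftPoly q a c t 1 * qPoch q (c * q ^ t) k / qPoch q (a * q / (c * q ^ t)) k := by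
    have h0 := gen 0 hc hC
    rw [pow_zero, mul_one] at h0
    rw [div_eq_div_iff h0 (gen t hc hC), ← qPoch_mul_shiftPoly_one hq ha hc]
    ring
  simp only [baileyTerm]
  generalize shiftPoly q a b s (q ^ k) = b1 at *
  generalize shiftPoly q a c t (q ^ k) = c1 at *
  generalize shiftPoly q a b s 1 = b2 at *
  generalize shiftPoly q a c t 1 = c2 at *
  generalize qPoch q b k = b3 at *
  generalize qPoch q c k = c3 at *
  generalize qPoch q (b * q ^ s) k = b4 at *
  generalize qPoch q (c * q ^ t) k = c4 at *
  generalize qPoch q (a * q / b) k = b5 at *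
  generalize qPoch q (a * q / c) k = c5 at *
  generalize qPoch q (a * q / (b * q ^ s)) k = b6 at *
  generalize qPoch q (a * q / (c * q ^ t)) k = c6 at *
  generalize qPoch q (a * q / d) k = x1
  generalize qPoch q (a * q / e) k = x2
  generalize qPoch q (a * q / f) k = x3
  generalize qPoch q (a * q / g) k = x4
  generalize qPoch q (a * q ^ (n + 1)) k = x5
  generalize qPoch q (q ^ n)⁻¹ k = x6
  generalize 1 - a * q ^ (2 * k) = x7
  generalize 1 - a = x8
  generalize q ^ k = x9
  generalize qPoch q a k = y1
  generalize qPoch q d k = y2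
  generalize qPoch q e k = y3
  generalize qPoch q f k = y4
  generalize qPoch q g k = y5
  generalize qPoch q q k = y6
  simp only [div_eq_mul_inv, mul_inv] at *
  linear_combination (x7 * x8⁻¹ * y1 * y2 * y3 * y4 * y5 * x6 * y6⁻¹ * x1⁻¹ * x2⁻¹ * x3⁻¹ * x4⁻¹ *
    x5⁻¹ * x9) * (c1 * c3 * c5⁻¹ * e1 + b2 * b4 * b6⁻¹ * e2)

/-- The constant of proportionality between the determinant of `shiftPoly`s and the Vandermonde
determinant of type `C`. -/
noncomputable def shiftPolyDet (q a b c : ℂ) (R : ℕ) : ℂ :=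
  ∏ i : Fin (R + 1), ∏ l ∈ range i, ((1 - b / c * (q ^ l / q ^ (R - i : ℕ))) *
      (1 - b * c / a * (q ^ l * q ^ (R - i : ℕ))) * (c / a * q ^ (R - i : ℕ)))

/-- Column `s` carries the parameters `b q^s` and `c q^(R-s)`, whose product `b c q^R` is the same
for all columns. This is the point of pairing `s` with `R - s`. -/
theorem shiftPolyDet_mul_crSum {q a b c : ℂ} (d e f g : ℂ) (hq : q ≠ 0) (hq1 : ‖q‖ < 1)
    (ha : a ≠ 0) (hb : b ≠ 0) (hc : c ≠ 0) (hB : QGeneric q (a / b)) (hC : QGeneric q (a / c))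
    (hac : QGeneric q (a / c ^ 2)) {R : ℕ} (n : Fin (R + 1) → ℕ) :
    shiftPolyDet q a b c R * crSum q a b c d e f g n =
      (∏ s : Fin (R + 1), (shiftPoly q a b s 1 * shiftPoly q a c (R - s) 1)) *
        (Matrix.of fun i s : Fin (R + 1) => ∑ k ∈ range (n i + 1),
          baileyTerm q a (b * q ^ (s : ℕ)) (c * q ^ (R - s : ℕ)) d (e * q ^ n i) f g (n i) k).det := by
  obtain ⟨D, hD⟩ := exists_det_shiftPoly_eq q b c ha R
  have hD' : D = shiftPolyDet q a b c R := det_shiftPoly_const_eq hq hq1 ha hc hac hD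
  rw [← hD', ← Matrix.det_mul_row]
  simp only [Matrix.of_apply, mul_sum, ← baileyTerm_mul_shiftPoly d _ f g hq ha hb hc hB hC]
  rw [det_sum_row, crSum, mul_sum]
  refine sum_congr rfl fun k _ => ?_
  -- At `z_i = q^{k_i}` the type `C` product is the Vandermonde factor of the summand.
  have h := hD (fun i => q ^ k i) fun i => pow_ne_zero _ hq
  rw [crFactor, ← mul_assoc]
  simp only [pow_add]
  rw [← h, mul_comm, ← Matrix.det_mul_column]
  rfl

/-- Isolates what changes under `(a, b, c) ↦ (l, l b / a, l c / a)`: the first product involves only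
`b / c` and `c / a`, which are preserved, while `x` goes from `l d / a` to `d`. -/
theorem shiftPolyDet_eq {q a b c x : ℂ} (hq : q ≠ 0) (ha : a ≠ 0) (hb : b ≠ 0) (hc : c ≠ 0) {R : ℕ}
    (hx : x = a * q / (b * c * q ^ R)) :
    shiftPolyDet q a b c R =
      (∏ i : Fin (R + 1), ∏ l ∈ range i, (1 - b / c * (q ^ l / q ^ (R - i : ℕ))) *
        (c / a * q ^ (R - i : ℕ)) * (-(q ^ l)⁻¹)) *
      ∏ i : Fin (R + 1), (x⁻¹) ^ (i : ℕ) * qPoch q x i := by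
  rw [shiftPolyDet, ← prod_mul_distrib]
  refine prod_congr rfl fun i _ => ?_
  have h : ∏ l ∈ range (i : ℕ), (1 - b * c / a * (q ^ l * q ^ (R - i : ℕ))) =
      ∏ l ∈ range (i : ℕ), (-(q ^ l)⁻¹) * (x⁻¹ * (1 - x * q ^ l)) := by
    rw [← prod_range_reflect]
    refine prod_congr rfl fun l hl => ?_
    have hl' := mem_range.1 hl
    have hi := i.2
    have e : q ^ R * q ^ (-1 : ℤ) = q ^ (i - 1 - l : ℕ) * q ^ (R - i : ℕ) * q ^ l := by
      rw [← zpow_natCast, ← zpow_add₀ hq, ← pow_add, ← pow_add, ← zpow_natCast]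
      congr 1
      omega
    have e' := eq_div_of_mul_eq (pow_ne_zero l hq) e.symm
    rw [e', hx, zpow_neg_one]
    field_simp
    ring
  have hx' : (x⁻¹) ^ (i : ℕ) = ∏ _l ∈ range (i : ℕ), x⁻¹ := by rw [prod_const, card_range]
  rw [prod_mul_distrib, prod_mul_distrib, h, hx', qPoch, ← prod_mul_distrib, ← prod_mul_distrib,
    ← prod_mul_distrib, ← prod_mul_distrib]
  refine prod_congr rfl fun l _ => ?_
  ring

theorem shiftPoly_one (q a b : ℂ) (s : ℕ) :
    shiftPoly q a b s 1 = qPoch q b s * qPoch q (b / a) s := by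
  rw [shiftPoly, qPoch, qPoch, ← prod_mul_distrib]
  refine prod_congr rfl fun l _ => ?_
  ring

theorem prod_shiftPoly_one (q a b c : ℂ) (R : ℕ) :
    ∏ s : Fin (R + 1), (shiftPoly q a b s 1 * shiftPoly q a c (R - s) 1) =
      (∏ s : Fin (R + 1), qPoch q b s * qPoch q c s) *
        ∏ s : Fin (R + 1), qPoch q (b / a) s * qPoch q (c / a) s := by
  have h : ∏ s : Fin (R + 1), shiftPoly q a c (R - s) 1 = ∏ s : Fin (R + 1), shiftPoly q a c s 1 := by
    rw [← Equiv.prod_comp Fin.revPerm]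
    refine prod_congr rfl fun s _ => ?_
    have : R - (Fin.revPerm s : ℕ) = s := by
      rw [Fin.revPerm_apply, Fin.val_rev]; omega
    rw [this]
  rw [prod_mul_distrib, h, ← prod_mul_distrib, ← prod_mul_distrib]
  refine prod_congr rfl fun s _ => ?_
  rw [shiftPoly_one, shiftPoly_one]
  ring

/-! ### Bailey's transformation for `C_r` series -/

/-- The factor of Bailey's transformation for a single summation index. -/
noncomputable def baileyFactor (q a l e f : ℂ) (n : ℕ) : ℂ :=
  qPoch q (a * q) n * qPoch q (a * q / (e * f)) n * qPoch q (l * q / e) n * qPoch q (l * q / f) n /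
    (qPoch q (a * q / e) n * qPoch q (a * q / f) n * qPoch q (l * q) n *
      qPoch q (l * q / (e * f)) n)

/-- The `C_r` extension of Bailey's transformation of terminating `₁₀φ₉` series, for generic
parameters. -/
theorem crSum_transformation {q a b c d e f g l : ℂ} {R : ℕ} (n : Fin (R + 1) → ℕ) (hq : q ≠ 0)
    (hq1 : ‖q‖ < 1) (ha : a ≠ 0) (hb : b ≠ 0) (hc : c ≠ 0) (hd : d ≠ 0) (he : e ≠ 0) (hf : f ≠ 0)
    (hg : g ≠ 0) (hl : l = a ^ 2 * q / (b * c * d * q ^ R)) (hbal : e * f * g = a * l * q)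
    (hA : QGeneric q a) (hL : QGeneric q l) (hAL : QGeneric q (a / l))
    (hB : QGeneric q (a / b)) (hC : QGeneric q (a / c)) (hD : QGeneric q (a / d))
    (hE : QGeneric q (a / e)) (hF : QGeneric q (a / f)) (hG : QGeneric q (a / g))
    (hLE : QGeneric q (l / e)) (hLF : QGeneric q (l / f)) (hLG : QGeneric q (l / g))
    (hCC : QGeneric q (a / c ^ 2)) (hLCC : QGeneric q (a ^ 2 / (l * c ^ 2)))
    (hBC : QGeneric q (b / c)) (hLB : QGeneric q (l * b / a)) (hLC : QGeneric q (l * c / a))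
    (hLD : QGeneric q (l * d / a)) :
    crSum q a b c d e f g n = (l / a) ^ ((R + 1).choose 2) *
      (∏ s ∈ range (R + 1), qPoch q b s * qPoch q c s * qPoch q d s /
        (qPoch q (l * b / a) s * qPoch q (l * c / a) s * qPoch q (l * d / a) s)) *
      (∏ i, baileyFactor q a l (e * q ^ n i) f (n i)) *
      crSum q l (l * b / a) (l * c / a) (l * d / a) e f g n := by
  have hl0 : l ≠ 0 := by rw [hl]; positivity
  have hqR : q ^ R ≠ 0 := pow_ne_zero _ hq
  have key1 := shiftPolyDet_mul_crSum d e f g hq hq1 ha hb hc hB hC hCC n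
  have key2 := shiftPolyDet_mul_crSum (a := l) (b := l * b / a) (c := l * c / a) (l * d / a) e f g
    hq hq1 hl0 (div_ne_zero (mul_ne_zero hl0 hb) ha) (div_ne_zero (mul_ne_zero hl0 hc) ha)
    (by rwa [show l / (l * b / a) = a / b by field_simp])
    (by rwa [show l / (l * c / a) = a / c by field_simp])
    (by rwa [show l / (l * c / a) ^ 2 = a ^ 2 / (l * c ^ 2) by field_simp]) n
  -- Bailey's transformation is applied entrywise with one common `l`. Taking `e q^{n_i}` and `f` as
  -- the distinguished pair makes its prefactor independent of the column, so it leaves the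
  -- determinant.
  have rows : (Matrix.of fun i s : Fin (R + 1) => ∑ k ∈ range (n i + 1),
        baileyTerm q a (b * q ^ (s : ℕ)) (c * q ^ (R - s : ℕ)) d (e * q ^ n i) f g (n i) k).det =
      (∏ i, baileyFactor q a l (e * q ^ n i) f (n i)) *
      (Matrix.of fun i s : Fin (R + 1) => ∑ k ∈ range (n i + 1),
        baileyTerm q l (l * b / a * q ^ (s : ℕ)) (l * c / a * q ^ (R - s : ℕ)) (l * d / a)
          (e * q ^ n i) f g (n i) k).det := by
    rw [← Matrix.det_mul_column]
    congr 1
    ext i s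
    simp only [Matrix.of_apply]
    have hqs : q ^ (s : ℕ) ≠ 0 := pow_ne_zero _ hq
    have hqt : q ^ (R - s : ℕ) ≠ 0 := pow_ne_zero _ hq
    have hqn : q ^ n i ≠ 0 := pow_ne_zero _ hq
    have hst : q ^ R = q ^ (s : ℕ) * q ^ (R - s : ℕ) := by
      rw [← pow_add, Nat.add_sub_cancel' (Nat.lt_succ_iff.1 s.2)]
    rw [bailey_transformation (l := l) hq hq1 ha (mul_ne_zero hb hqs) (mul_ne_zero hc hqt) hd
      (mul_ne_zero he hqn) hf hg (by rw [hl, hst]; congr 1; ring)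
      (by linear_combination q ^ n i * hbal) hA hL hAL
      (hB.of_eq hq (-(s : ℕ)) (by rw [zpow_neg, zpow_natCast]; field_simp))
      (hC.of_eq hq (-(R - s : ℕ)) (by rw [zpow_neg, zpow_natCast]; field_simp)) hD
      (hE.of_eq hq (-(n i : ℕ)) (by rw [zpow_neg, zpow_natCast]; field_simp)) hF hG
      (hLE.of_eq hq (-(n i : ℕ)) (by rw [zpow_neg, zpow_natCast]; field_simp)) hLF hLG,
      baileyFactor, show l * (b * q ^ (s : ℕ)) / a = l * b / a * q ^ (s : ℕ) by ring,
      show l * (c * q ^ (R - s : ℕ)) / a = l * c / a * q ^ (R - s : ℕ) by ring]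
  rw [rows, prod_shiftPoly_one, shiftPolyDet_eq (x := l * d / a) hq ha hb hc
    (by rw [hl]; field_simp)] at key1
  rw [prod_shiftPoly_one, shiftPolyDet_eq (x := d) hq hl0
    (div_ne_zero (mul_ne_zero hl0 hb) ha) (div_ne_zero (mul_ne_zero hl0 hc) ha)
    (by rw [hl]; field_simp),
    show l * b / a / (l * c / a) = b / c by field_simp,
    show l * c / a / l = c / a by field_simp,
    show l * b / a / l = b / a by field_simp] at key2
  -- `K` and `M` are the parts common to the original and the transformed series; they cancel once
  -- they are known to be nonzero.
  set K := ∏ i : Fin (R + 1), ∏ l ∈ range i, (1 - b / c * (q ^ l / q ^ (R - i : ℕ))) *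
        (c / a * q ^ (R - i : ℕ)) * (-(q ^ l)⁻¹) with hK
  set M := ∏ s : Fin (R + 1), qPoch q (b / a) s * qPoch q (c / a) s with hM
  have hK0 : K ≠ 0 := by
    refine prod_ne_zero_iff.2 fun i _ => prod_ne_zero_iff.2 fun l _ => ?_
    refine mul_ne_zero (mul_ne_zero ?_ ?_) ?_
    · intro h
      apply hBC ((l : ℤ) - (R - i : ℕ))
      rw [zpow_sub₀ hq, zpow_natCast, zpow_natCast]
      exact (sub_eq_zero.1 h).symm
    · exact mul_ne_zero (div_ne_zero hc ha) (pow_ne_zero _ hq)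
    · exact neg_ne_zero.2 (inv_ne_zero (pow_ne_zero _ hq))
  have hM0 : M ≠ 0 := by
    refine prod_ne_zero_iff.2 fun s _ => mul_ne_zero ?_ ?_
    · rw [← inv_div]; exact hB.inv.qPoch_ne_zero _
    · rw [← inv_div]; exact hC.inv.qPoch_ne_zero _
  have pow_aux : ∀ x : ℂ, ∏ i : Fin (R + 1), (x⁻¹) ^ (i : ℕ) = (x⁻¹) ^ ((R + 1).choose 2) := by
    intro x
    rw [prod_pow_eq_pow_sum, Fin.sum_univ_eq_sum_range (fun i => i), sum_range_id,
      Nat.choose_two_right]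
  rw [prod_mul_distrib, pow_aux, inv_pow] at key1 key2
  rw [prod_mul_distrib (g := fun s : Fin (R + 1) => qPoch q c s)] at key1
  rw [prod_mul_distrib (g := fun s : Fin (R + 1) => qPoch q (l * c / a) s)] at key2
  have range_eq : ∀ x : ℂ, ∏ s : Fin (R + 1), qPoch q x s = ∏ s ∈ range (R + 1), qPoch q x s :=
    fun x => Fin.prod_univ_eq_prod_range (fun s => qPoch q x s) (R + 1)
  simp only [range_eq] at key1 key2
  have nz : ∀ {x : ℂ}, QGeneric q x → ∏ s ∈ range (R + 1), qPoch q x s ≠ 0 := fun h =>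
    prod_ne_zero_iff.2 fun s _ => h.qPoch_ne_zero s
  rw [prod_div_distrib, prod_mul_distrib, prod_mul_distrib, prod_mul_distrib, prod_mul_distrib]
  have hLB' := nz hLB
  have hLC' := nz hLC
  have hLD' := nz hLD
  have hy0 : d ^ ((R + 1).choose 2) ≠ 0 := pow_ne_zero _ hd
  have hz0 : (l / a) ^ ((R + 1).choose 2) ≠ 0 := pow_ne_zero _ (div_ne_zero hl0 ha)
  have hxy : (l * d / a) ^ ((R + 1).choose 2) = (l / a) ^ ((R + 1).choose 2) *
      d ^ ((R + 1).choose 2) := by rw [← mul_pow]; congr 1; ring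
  rw [hxy] at key1
  clear_value K M
  clear rows hxy
  generalize (Matrix.of fun i s : Fin (R + 1) => ∑ k ∈ range (n i + 1),
        baileyTerm q l (l * b / a * q ^ (s : ℕ)) (l * c / a * q ^ (R - s : ℕ)) (l * d / a)
          (e * q ^ n i) f g (n i) k).det = Δ at *
  generalize crSum q a b c d e f g n = S1 at *
  generalize crSum q l (l * b / a) (l * c / a) (l * d / a) e f g n = S2 at *
  generalize ∏ s ∈ range (R + 1), qPoch q (l * b / a) s = p1 at *
  generalize ∏ s ∈ range (R + 1), qPoch q (l * c / a) s = p2 at *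
  generalize ∏ s ∈ range (R + 1), qPoch q (l * d / a) s = p3 at *
  generalize ∏ s ∈ range (R + 1), qPoch q b s = p4 at *
  generalize ∏ s ∈ range (R + 1), qPoch q c s = p5 at *
  generalize ∏ s ∈ range (R + 1), qPoch q d s = p6 at *
  generalize ∏ i, baileyFactor q a l (e * q ^ n i) f (n i) = p7 at *
  generalize d ^ ((R + 1).choose 2) = y at *
  generalize (l / a) ^ ((R + 1).choose 2) = z at *
  rw [mul_inv] at key1
  have hΔ : Δ = K * (y⁻¹ * p6) * S2 / (p1 * p2 * M) := by
    rw [eq_div_iff (mul_ne_zero (mul_ne_zero hLB' hLC') hM0), key2]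
    ring
  have hS : S1 = p4 * p5 * M * (p7 * Δ) / (K * (z⁻¹ * y⁻¹ * p3)) := by
    rw [eq_div_iff (mul_ne_zero hK0 (mul_ne_zero (mul_ne_zero (inv_ne_zero hz0) (inv_ne_zero hy0))
      hLD')), ← key1]
    ring
  rw [hS, hΔ]
  field_simp

/-! ### Two applications of the transformation -/

theorem QGeneric.of_mul_pow_eq {q x y : ℂ} (h : QGeneric q x) (hq : q ≠ 0) (m k : ℕ)
    (hy : y * q ^ m = x * q ^ k) : QGeneric q y := by
  refine h.of_eq hq ((k : ℤ) - m) ?_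
  rw [zpow_sub₀ hq, zpow_natCast, zpow_natCast, ← mul_div_assoc, ← hy,
    mul_div_cancel_right₀ _ (pow_ne_zero _ hq)]

/-- The parameters are generic along a weighted curve: no monomial of nonzero weight is an integral
power of `q`. -/
def GenericParams (q a b c d f g : ℂ) : Prop :=
  ∀ i₁ i₂ i₃ i₄ i₅ i₆ : ℤ, i₁ + 2 * i₂ + 3 * i₃ + 2 * i₄ + 2 * i₅ + 3 * i₆ ≠ 0 →
    QGeneric q (a ^ i₁ * b ^ i₂ * c ^ i₃ * d ^ i₄ * f ^ i₅ * g ^ i₆)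

/-- Brings `f, g` and the former `b` into the three slots on which the second transformation acts.
-/
theorem crSum_permute (q a b c d e f g : ℂ) {r : ℕ} (n : Fin r → ℕ) :
    crSum q a b c d e f g n = crSum q a f g b e c d n := by
  refine sum_congr rfl fun k _ => congrArg (crFactor q a k * ·) (prod_congr rfl fun i _ => ?_)
  simp only [baileyTerm]
  generalize qPoch q b (k i) = x1
  generalize qPoch q c (k i) = x2
  generalize qPoch q d (k i) = x3
  generalize qPoch q (e * q ^ n i) (k i) = x4
  generalize qPoch q f (k i) = x5
  generalize qPoch q g (k i) = x6
  generalize qPoch q (a * q / b) (k i) = y1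
  generalize qPoch q (a * q / c) (k i) = y2
  generalize qPoch q (a * q / d) (k i) = y3
  generalize qPoch q (a * q / (e * q ^ n i)) (k i) = y4
  generalize qPoch q (a * q / f) (k i) = y5
  generalize qPoch q (a * q / g) (k i) = y6
  refine congrArg₂ (· * ·) (congrArg₂ (· / ·) (congrArg₂ (· * ·) rfl ?_) ?_) rfl <;> ring

/-- The factorials of `l q` and `l q / (e q^n)` cancel. Of the remaining factorials containing `l`
or `m`, three in the numerator and three in the denominator are reversed: their common sign-and-`q`
factors cancel, and the leftover powers combine to `(e q^n)^n`. -/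
theorem baileyFactor_mul_baileyFactor {q a b c d e f g l m y : ℂ} {R n : ℕ} (hq : q ≠ 0)
    (ha : a ≠ 0) (hb : b ≠ 0) (hc : c ≠ 0) (hd : d ≠ 0) (he : e ≠ 0) (hf : f ≠ 0) (hg : g ≠ 0)
    (hl : l = a ^ 2 * q / (b * c * d * q ^ R)) (hm : m = e / (b * q ^ R)) (hy : y = l * c / a)
    (hbal : e = a ^ 3 * q ^ 2 / (b * c * d * f * g * q ^ R))
    (hL : QGeneric q l) (hLE : QGeneric q (l / e)) (hD : QGeneric q (a / d))
    (hG : QGeneric q (a / g)) (hM : QGeneric q m) :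
    baileyFactor q a l (e * q ^ n) f n * baileyFactor q l m (e * q ^ n) y n =
      qPoch q (a * q) n * qPoch q (a * (q / q ^ n) / (c * e)) n *
        qPoch q (a * (q / q ^ n) / (d * e)) n * qPoch q (a * (q / q ^ n) / (e * f)) n *
        qPoch q (a * (q / q ^ n) / (e * g)) n * qPoch q (b * q ^ R) n /
      (qPoch q (a * q / c) n * qPoch q (a * q / d) n * qPoch q (a * (q / q ^ n) / e) n *
        qPoch q (a * q / f) n * qPoch q (a * q / g) n * qPoch q (b * (q ^ R / q ^ n) / e) n) *
      (e * q ^ n) ^ n := by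
  have hqR : q ^ R ≠ 0 := pow_ne_zero _ hq
  have hqn : q ^ n ≠ 0 := pow_ne_zero _ hq
  have hl0 : l ≠ 0 := by rw [hl]; positivity
  have r1 : a * q / (e * q ^ n * f) = a * (q / q ^ n) / (e * f) := by field_simp
  have r2 : a * q / (e * q ^ n) = a * (q / q ^ n) / e := by field_simp
  have r3 : l * q / (e * q ^ n * y) = a * (q / q ^ n) / (c * e) := by rw [hy]; field_simp
  have r4 : l * q / y = a * q / c := by rw [hy]; field_simp
  have s1 : l * q / f = (a / (e * q ^ n * g) * q ^ n)⁻¹ := by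
    rw [hl, hbal]; field_simp
  have s2 : m * q / (e * q ^ n) = (b * q ^ R / q * q ^ n)⁻¹ := by rw [hm]; field_simp
  have s3 : m * q / y = (a / (e * q ^ n * d) * q ^ n)⁻¹ := by rw [hm, hy, hl]; field_simp
  have s4 : l * q / (e * q ^ n * f) = (a / g * q ^ n)⁻¹ := by
    rw [hl, hbal]; field_simp
  have s5 : m * q / (e * q ^ n * y) = (a / d * q ^ n)⁻¹ := by rw [hm, hy, hl]; field_simp
  have s6 : m * q = (b * q ^ R / (e * q ^ n * q) * q ^ n)⁻¹ := by rw [hm]; field_simp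
  have t1 := qPoch_inv_mul_pow (y := a / (e * q ^ n * g)) hq (by positivity) n
  have t2 := qPoch_inv_mul_pow (y := b * q ^ R / q) hq (by positivity) n
  have t3 := qPoch_inv_mul_pow (y := a / (e * q ^ n * d)) hq (by positivity) n
  have t4 := qPoch_inv_mul_pow (y := a / g) hq (by positivity) n
  have t5 := qPoch_inv_mul_pow (y := a / d) hq (by positivity) n
  have t6 := qPoch_inv_mul_pow (y := b * q ^ R / (e * q ^ n * q)) hq (by positivity) n
  have n1 : qPoch q (m * q) n ≠ 0 := (hM.of_mul_pow_eq hq 0 1 (by ring)).qPoch_ne_zero n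
  have n2 : qPoch q (a / g * q ^ n)⁻¹ n ≠ 0 :=
    (hG.inv.of_mul_pow_eq hq n 0 (by field_simp)).qPoch_ne_zero n
  have n3 : qPoch q (a / d * q ^ n)⁻¹ n ≠ 0 :=
    (hD.inv.of_mul_pow_eq hq n 0 (by field_simp)).qPoch_ne_zero n
  have n4 : qPoch q (l * q) n ≠ 0 := (hL.of_mul_pow_eq hq 0 1 (by ring)).qPoch_ne_zero n
  have n5 : qPoch q (l * q / (e * q ^ n)) n ≠ 0 :=
    (hLE.of_mul_pow_eq hq n 1 (by field_simp)).qPoch_ne_zero n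
  have u1 : a / (e * q ^ n * g) * q = a * (q / q ^ n) / (e * g) := by field_simp
  have u2 : b * q ^ R / q * q = b * q ^ R := by field_simp
  have u3 : a / (e * q ^ n * d) * q = a * (q / q ^ n) / (d * e) := by field_simp
  have u4 : a / g * q = a * q / g := by ring
  have u5 : a / d * q = a * q / d := by ring
  have u6 : b * q ^ R / (e * q ^ n * q) * q = b * (q ^ R / q ^ n) / e := by field_simp
  rw [s6] at n1
  rw [u1, ← s1] at t1
  rw [u2, ← s2] at t2
  rw [u3, ← s3] at t3
  rw [u4, ← s4] at t4
  rw [u5, ← s5] at t5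
  rw [u6, ← s6] at t6
  rw [← s4] at n2
  rw [← s5] at n3
  rw [← s6] at n1
  have hκ : ∏ i ∈ range n, -(q ^ i / q ^ n) ≠ 0 :=
    prod_ne_zero_iff.2 fun i _ => neg_ne_zero.2 (div_ne_zero (pow_ne_zero _ hq) hqn)
  have v : (e * q ^ n) ^ n * (a / (e * q ^ n * g)) ^ n * (b * q ^ R / q) ^ n *
      (a / (e * q ^ n * d)) ^ n =
      (a / g) ^ n * (a / d) ^ n * (b * q ^ R / (e * q ^ n * q)) ^ n := by
    simp only [← mul_pow]; congr 1; field_simp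
  have w1 : (a / (e * q ^ n * g)) ^ n ≠ 0 := by positivity
  have w2 : (b * q ^ R / q) ^ n ≠ 0 := by positivity
  have w3 : (a / (e * q ^ n * d)) ^ n ≠ 0 := by positivity
  have w4 : (a / g) ^ n ≠ 0 := by positivity
  have w5 : (a / d) ^ n ≠ 0 := by positivity
  have w6 : (b * q ^ R / (e * q ^ n * q)) ^ n ≠ 0 := by positivity
  have n2' : qPoch q (a * q / g) n ≠ 0 := right_ne_zero_of_mul (t4 ▸ mul_ne_zero w4 n2)
  have n3' : qPoch q (a * q / d) n ≠ 0 := right_ne_zero_of_mul (t5 ▸ mul_ne_zero w5 n3)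
  have n1' : qPoch q (b * (q ^ R / q ^ n) / e) n ≠ 0 :=
    right_ne_zero_of_mul (t6 ▸ mul_ne_zero w6 n1)
  simp only [baileyFactor, r1, r2, r3, r4]
  rw [div_mul_div_comm, div_mul_eq_mul_div]
  clear r1 r2 r3 r4 s1 s2 s3 s4 s5 s6 u1 u2 u3 u4 u5 u6 hl hm hy hbal
  generalize qPoch q (a * (q / q ^ n) / (e * f)) n = x1 at *
  generalize qPoch q (a * (q / q ^ n) / e) n = x2 at *
  generalize qPoch q (a * (q / q ^ n) / (c * e)) n = x3 at *
  generalize qPoch q (a * q / c) n = x4 at *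
  generalize qPoch q (a * q / f) n = x5 at *
  generalize qPoch q (a * q) n = x6 at *
  generalize qPoch q (l * q) n = x7 at *
  generalize qPoch q (l * q / (e * q ^ n)) n = x8 at *
  generalize qPoch q (l * q / f) n = p1 at *
  generalize qPoch q (m * q / (e * q ^ n)) n = p2 at *
  generalize qPoch q (m * q / y) n = p3 at *
  generalize qPoch q (l * q / (e * q ^ n * f)) n = p4 at *
  generalize qPoch q (m * q / (e * q ^ n * y)) n = p5 at *
  generalize qPoch q (m * q) n = p6 at *
  generalize qPoch q (a * (q / q ^ n) / (e * g)) n = P1 at *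
  generalize qPoch q (b * q ^ R) n = P2 at *
  generalize qPoch q (a * (q / q ^ n) / (d * e)) n = P3 at *
  generalize qPoch q (a * q / g) n = P4 at *
  generalize qPoch q (a * q / d) n = P5 at *
  generalize qPoch q (b * (q ^ R / q ^ n) / e) n = P6 at *
  generalize (a / (e * q ^ n * g)) ^ n = y1 at *
  generalize (b * q ^ R / q) ^ n = y2 at *
  generalize (a / (e * q ^ n * d)) ^ n = y3 at *
  generalize (a / g) ^ n = y4 at *
  generalize (a / d) ^ n = y5 at *
  generalize (b * q ^ R / (e * q ^ n * q)) ^ n = y6 at *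
  generalize (e * q ^ n) ^ n = E at *
  generalize ∏ i ∈ range n, -(q ^ i / q ^ n) = κ at *
  have hT : y1 * y2 * y3 * (y4 * y5 * y6) ≠ 0 := by positivity
  have hS : κ ^ 3 * (y1 * y2 * y3) * (x7 * x8) ≠ 0 := by positivity
  refine div_eq_div_of_mul hT hS ?_ ?_
  · have h : y1 * p1 * (y2 * p2) * (y3 * p3) = κ * P1 * (κ * P2) * (κ * P3) := by rw [t1, t2, t3]
    linear_combination x6 * x1 * x8 * x7 * x3 * (y4 * y5 * y6 * h - κ ^ 3 * P1 * P2 * P3 * v)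
  · have h : y4 * p4 * (y5 * p5) * (y6 * p6) = κ * P4 * (κ * P5) * (κ * P6) := by rw [t4, t5, t6]
    linear_combination x2 * x5 * x7 * x8 * x4 * y1 * y2 * y3 * h

/-- The left-hand side of the `C_r` transformation. -/
noncomputable def crLHS {r : ℕ} (q : ℂ) (n : Fin r → ℕ) (a b c d e f g : ℂ) : ℂ :=
  ∑ k ∈ multiBox n,
        crFactor q a k *
          (∏ i, (1 - a * q ^ (2 * k i)) *
            qPochs q [a, b, c, d, e * q ^ n i, f, g, q ^ (-(n i : ℤ))] (k i) /
            ((1 - a) *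
              qPochs q [q, a * q / b, a * q / c, a * q / d, a * q ^ (1 - (n i : ℤ)) / e,
                a * q / f, a * q / g, a * q ^ (1 + n i)] (k i))) *
          q ^ (∑ i, k i)

/-- The right-hand side of the `C_r` transformation. -/
noncomputable def crRHS {r : ℕ} (q : ℂ) (n : Fin r → ℕ) (a b c d e f g : ℂ) : ℂ :=
  (a ^ 2 * q ^ (4 - 2 * (r : ℤ)) / (b ^ 2 * c * d * f * g)) ^ (r.choose 2) *
        (∏ i ∈ Icc 1 (r - 1),
          qPochs q [b, c, d, f, g] i /
            qPochs q [a * q ^ (2 - (r : ℤ)) / (b * c), a * q ^ (2 - (r : ℤ)) / (b * d),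
              a * q ^ (2 - (r : ℤ)) / (b * f), a * q ^ (2 - (r : ℤ)) / (b * g),
              a ^ 2 * q ^ (4 - 2 * (r : ℤ)) / (b * c * d * f * g)] i) *
        (∏ i,
          qPochs q [a * q, a * q ^ (1 - (n i : ℤ)) / (c * e), a * q ^ (1 - (n i : ℤ)) / (d * e),
              a * q ^ (1 - (n i : ℤ)) / (e * f), a * q ^ (1 - (n i : ℤ)) / (e * g),
              b * q ^ (r - 1)] (n i) /
            qPochs q [a * q / c, a * q / d, a * q ^ (1 - (n i : ℤ)) / e, a * q / f,
              a * q / g, b * q ^ ((r : ℤ) - 1 - n i) / e] (n i) *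
            (e * q ^ n i) ^ n i) *
        ∑ k ∈ multiBox n,
          crFactor q (e * q ^ (1 - (r : ℤ)) / b) k *
            (∏ i, (1 - e * q ^ (1 - (r : ℤ) + 2 * k i) / b) *
              qPochs q [e * q ^ (1 - (r : ℤ)) / b, e * q ^ (1 - (r : ℤ)) / a,
                a * q ^ (2 - (r : ℤ)) / (b * f), a * q ^ (2 - (r : ℤ)) / (b * g)] (k i) /
              ((1 - e * q ^ (1 - (r : ℤ)) / b) *
                qPochs q [q, a * q / b, e * f / a, e * g / a] (k i))) *
            (∏ i,
              qPochs q [e * q ^ n i, a * q ^ (2 - (r : ℤ)) / (b * c),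
                a * q ^ (2 - (r : ℤ)) / (b * d), q ^ (-(n i : ℤ))] (k i) /
              qPochs q [q ^ (2 - (r : ℤ) - n i) / b, e * c / a, e * d / a,
                e * q ^ (2 - (r : ℤ) + n i) / b] (k i)) *
            q ^ (∑ i, k i)

theorem crLHS_eq_crSum {r : ℕ} {q : ℂ} (hq : q ≠ 0) (n : Fin r → ℕ) (a b c d e f g : ℂ) :
    crLHS q n a b c d e f g = crSum q a b c d e f g n := by
  refine sum_congr rfl fun k _ => ?_
  rw [mul_assoc, ← prod_pow_eq_pow_sum, ← prod_mul_distrib]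
  refine congrArg (crFactor q a k * ·) (prod_congr rfl fun i _ => ?_)
  have e1 : q ^ (-(n i : ℤ)) = (q ^ n i)⁻¹ := by rw [zpow_neg, zpow_natCast]
  have e2 : a * q ^ (1 - (n i : ℤ)) / e = a * q / (e * q ^ n i) := by
    rw [zpow_sub₀ hq, zpow_one, zpow_natCast, ← mul_div_assoc, div_div, mul_comm e]
  have e3 : a * q ^ (1 + n i) = a * q ^ (n i + 1) := by rw [add_comm]
  simp only [qPochs_cons, qPochs_nil, baileyTerm, e1, e2, e3, mul_one]
  simp only [div_eq_mul_inv, mul_inv]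
  generalize qPoch q (a * q * (e⁻¹ * (q ^ n i)⁻¹)) (k i) = y1
  generalize qPoch q (a * q * b⁻¹) (k i) = y2
  generalize qPoch q (a * q * c⁻¹) (k i) = y3
  generalize qPoch q (a * q * d⁻¹) (k i) = y4
  generalize qPoch q (a * q * f⁻¹) (k i) = y5
  generalize qPoch q (a * q * g⁻¹) (k i) = y6
  generalize qPoch q (q ^ n i)⁻¹ (k i) = y7
  generalize qPoch q (a * q ^ (n i + 1)) (k i) = y8
  generalize 1 - a = y9
  generalize 1 - a * q ^ (2 * k i) = y0
  ring

theorem sum_crRHS_eq_crSum {R : ℕ} {q a b c d e f g : ℂ} (hq : q ≠ 0) (ha : a ≠ 0) (hb : b ≠ 0)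
    (hc : c ≠ 0) (hd : d ≠ 0) (he : e ≠ 0) (hf : f ≠ 0) (hg : g ≠ 0) (n : Fin (R + 1) → ℕ) :
    ∑ k ∈ multiBox n,
      crFactor q (e / (b * q ^ R)) k *
        (∏ i, (1 - e * (q ^ (2 * k i) / q ^ R) / b) *
          qPochs q [e / (b * q ^ R), e * (q ^ R)⁻¹ / a,
            a * (q / q ^ R) / (b * f), a * (q / q ^ R) / (b * g)] (k i) /
          ((1 - e / (b * q ^ R)) *
            qPochs q [q, a * q / b, e * f / a, e * g / a] (k i))) *
        (∏ i,
          qPochs q [e * q ^ n i, a * (q / q ^ R) / (b * c),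
            a * (q / q ^ R) / (b * d), (q ^ n i)⁻¹] (k i) /
          qPochs q [q / (q ^ R * q ^ n i) / b, e * c / a, e * d / a,
            e * (q * q ^ n i / q ^ R) / b] (k i)) *
        q ^ (∑ i, k i) =
      crSum q (e / (b * q ^ R)) (a * (q / q ^ R) / (b * g)) (a * (q / q ^ R) / (b * f))
        (e * (q ^ R)⁻¹ / a) e (a * (q / q ^ R) / (b * d)) (a * (q / q ^ R) / (b * c)) n := by
  refine sum_congr rfl fun k _ => ?_
  rw [mul_assoc, mul_assoc, ← prod_pow_eq_pow_sum, ← prod_mul_distrib, ← prod_mul_distrib]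
  refine congrArg (crFactor q _ k * ·) (prod_congr rfl fun i _ => ?_)
  have hqR : q ^ R ≠ 0 := pow_ne_zero _ hq
  have hqn : q ^ n i ≠ 0 := pow_ne_zero _ hq
  have e1 : e * (q ^ (2 * k i) / q ^ R) / b = e / (b * q ^ R) * q ^ (2 * k i) := by field_simp
  have e2 : e / (b * q ^ R) * q / (e * (q ^ R)⁻¹ / a) = a * q / b := by field_simp
  have e3 : e / (b * q ^ R) * q / (a * (q / q ^ R) / (b * f)) = e * f / a := by field_simp
  have e4 : e / (b * q ^ R) * q / (a * (q / q ^ R) / (b * g)) = e * g / a := by field_simp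
  have e5 : e / (b * q ^ R) * q / (a * (q / q ^ R) / (b * c)) = e * c / a := by field_simp
  have e6 : e / (b * q ^ R) * q / (a * (q / q ^ R) / (b * d)) = e * d / a := by field_simp
  have e7 : e / (b * q ^ R) * q / (e * q ^ n i) = q / (q ^ R * q ^ n i) / b := by field_simp
  have e8 : e / (b * q ^ R) * q ^ (n i + 1) = e * (q * q ^ n i / q ^ R) / b := by
    rw [pow_succ]; field_simp
  simp only [qPochs_cons, qPochs_nil, baileyTerm, e1, e2, e3, e4, e5, e6, e7, e8, mul_one]
  generalize qPoch q (a * q / b) (k i) = x1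
  generalize qPoch q (e * f / a) (k i) = x2
  generalize qPoch q (e * g / a) (k i) = x3
  generalize qPoch q (e * c / a) (k i) = x4
  generalize qPoch q (e * d / a) (k i) = x5
  generalize qPoch q (q / (q ^ R * q ^ n i) / b) (k i) = x6
  generalize qPoch q (e * (q * q ^ n i / q ^ R) / b) (k i) = x7
  generalize qPoch q (e / (b * q ^ R)) (k i) = x8
  generalize qPoch q (e * (q ^ R)⁻¹ / a) (k i) = x9
  generalize qPoch q (a * (q / q ^ R) / (b * f)) (k i) = y1
  generalize qPoch q (a * (q / q ^ R) / (b * g)) (k i) = y2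
  generalize qPoch q (a * (q / q ^ R) / (b * c)) (k i) = y3
  generalize qPoch q (a * (q / q ^ R) / (b * d)) (k i) = y4
  generalize qPoch q (q ^ n i)⁻¹ (k i) = y5
  generalize qPoch q (e * q ^ n i) (k i) = y6
  generalize 1 - e / (b * q ^ R) * q ^ (2 * k i) = y7
  generalize 1 - e / (b * q ^ R) = y8
  simp only [div_eq_mul_inv, mul_inv]
  ring

/-- The transformation is used on `b, c, d` with new base `l`, then on `f, g, l b / a` with new base
`m = e / (b q^R)`; the balancing condition is what identifies this base. -/
theorem crLHS_eq_crRHS_of_generic {R : ℕ} {q a b c d e f g : ℂ} (hq : q ≠ 0) (hq1 : ‖q‖ < 1)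
    (n : Fin (R + 1) → ℕ) (ha : a ≠ 0) (hb : b ≠ 0) (hc : c ≠ 0) (hd : d ≠ 0) (hf : f ≠ 0)
    (hg : g ≠ 0) (he : e = a ^ 3 * q ^ 2 / (b * c * d * f * g * q ^ R))
    (H : GenericParams q a b c d f g) :
    crLHS q n a b c d e f g = crRHS q n a b c d e f g := by
  have hqR : q ^ R ≠ 0 := pow_ne_zero _ hq
  have he0 : e ≠ 0 := by rw [he]; positivity
  obtain ⟨l, hl⟩ : ∃ l, l = a ^ 2 * q / (b * c * d * q ^ R) := ⟨_, rfl⟩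
  have hl0 : l ≠ 0 := by rw [hl]; positivity
  obtain ⟨m, hm⟩ : ∃ m, m = e / (b * q ^ R) := ⟨_, rfl⟩
  -- After eliminating `e`, `l` and `m`, every genericity condition concerns a Laurent monomial in
  -- `a, b, c, d, f, g` times a power of `q`. The six integers are its exponents, the two naturals
  -- its powers of `q`.
  have h1 := crSum_transformation (a := a) (b := b) (c := c) (d := d) (e := e) (f := f) (g := g)
    n hq hq1 ha hb hc hd he0 hf hg hl (by rw [he, hl]; field_simp)
    ((H 1 0 0 0 0 0 (by norm_num)).of_mul_pow_eq hq 0 0 (by field_simp))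
    ((H 2 (-1) (-1) (-1) 0 0 (by norm_num)).of_mul_pow_eq hq R 1 (by rw [hl]; field_simp))
    ((H (-1) 1 1 1 0 0 (by norm_num)).of_mul_pow_eq hq 1 R (by rw [hl]; field_simp))
    ((H 1 (-1) 0 0 0 0 (by norm_num)).of_mul_pow_eq hq 0 0 (by field_simp))
    ((H 1 0 (-1) 0 0 0 (by norm_num)).of_mul_pow_eq hq 0 0 (by field_simp))
    ((H 1 0 0 (-1) 0 0 (by norm_num)).of_mul_pow_eq hq 0 0 (by field_simp))
    ((H (-2) 1 1 1 1 1 (by norm_num)).of_mul_pow_eq hq 2 R (by rw [he]; field_simp))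
    ((H 1 0 0 0 (-1) 0 (by norm_num)).of_mul_pow_eq hq 0 0 (by field_simp))
    ((H 1 0 0 0 0 (-1) (by norm_num)).of_mul_pow_eq hq 0 0 (by field_simp))
    ((H (-1) 0 0 0 1 1 (by norm_num)).of_mul_pow_eq hq 1 0 (by rw [hl, he]; field_simp))
    ((H 2 (-1) (-1) (-1) (-1) 0 (by norm_num)).of_mul_pow_eq hq R 1 (by rw [hl]; field_simp))
    ((H 2 (-1) (-1) (-1) 0 (-1) (by norm_num)).of_mul_pow_eq hq R 1 (by rw [hl]; field_simp))
    ((H 1 0 (-2) 0 0 0 (by norm_num)).of_mul_pow_eq hq 0 0 (by field_simp))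
    ((H 0 1 (-1) 1 0 0 (by norm_num)).of_mul_pow_eq hq 1 R (by rw [hl]; field_simp))
    ((H 0 1 (-1) 0 0 0 (by norm_num)).of_mul_pow_eq hq 0 0 (by field_simp))
    ((H 1 0 (-1) (-1) 0 0 (by norm_num)).of_mul_pow_eq hq R 1 (by rw [hl]; field_simp))
    ((H 1 (-1) 0 (-1) 0 0 (by norm_num)).of_mul_pow_eq hq R 1 (by rw [hl]; field_simp))
    ((H 1 (-1) (-1) 0 0 0 (by norm_num)).of_mul_pow_eq hq R 1 (by rw [hl]; field_simp))
  have h2 := crSum_transformation (a := l) (b := f) (c := g) (d := l * b / a) (e := e)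
    (f := l * c / a) (g := l * d / a) (l := m)
    n hq hq1 hl0 hf hg (by positivity) he0 (by positivity) (by positivity)
    (by rw [hm, hl, he]; field_simp) (by rw [hm, hl]; field_simp)
    ((H 2 (-1) (-1) (-1) 0 0 (by norm_num)).of_mul_pow_eq hq R 1 (by rw [hl]; field_simp))
    ((H 3 (-2) (-1) (-1) (-1) (-1) (by norm_num)).of_mul_pow_eq hq (2 * R) 2
      (by rw [hm, he]; field_simp; ring))
    ((H (-1) 1 0 0 1 1 (by norm_num)).of_mul_pow_eq hq 1 R (by rw [hl, hm, he]; field_simp))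
    ((H 2 (-1) (-1) (-1) (-1) 0 (by norm_num)).of_mul_pow_eq hq R 1 (by rw [hl]; field_simp))
    ((H 2 (-1) (-1) (-1) 0 (-1) (by norm_num)).of_mul_pow_eq hq R 1 (by rw [hl]; field_simp))
    ((H 1 (-1) 0 0 0 0 (by norm_num)).of_mul_pow_eq hq 0 0 (by field_simp))
    ((H (-1) 0 0 0 1 1 (by norm_num)).of_mul_pow_eq hq 1 0 (by rw [hl, he]; field_simp))
    ((H 1 0 (-1) 0 0 0 (by norm_num)).of_mul_pow_eq hq 0 0 (by field_simp))
    ((H 1 0 0 (-1) 0 0 (by norm_num)).of_mul_pow_eq hq 0 0 (by field_simp))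
    ((H 0 (-1) 0 0 0 0 (by norm_num)).of_mul_pow_eq hq R 0 (by rw [hm]; field_simp))
    ((H 2 (-1) (-1) 0 (-1) (-1) (by norm_num)).of_mul_pow_eq hq R 1
      (by rw [hm, hl, he]; field_simp))
    ((H 2 (-1) 0 (-1) (-1) (-1) (by norm_num)).of_mul_pow_eq hq R 1
      (by rw [hm, hl, he]; field_simp))
    ((H 2 (-1) (-1) (-1) 0 (-2) (by norm_num)).of_mul_pow_eq hq R 1 (by rw [hl]; field_simp))
    ((H 1 0 (-1) (-1) 1 (-1) (by norm_num)).of_mul_pow_eq hq 0 0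
      (by rw [hl, hm, he]; field_simp))
    ((H 0 0 0 0 1 (-1) (by norm_num)).of_mul_pow_eq hq 0 0 (by field_simp))
    ((H 1 (-1) 0 0 0 (-1) (by norm_num)).of_mul_pow_eq hq R 1 (by rw [hl, hm, he]; field_simp))
    ((H 1 (-1) 0 0 (-1) 0 (by norm_num)).of_mul_pow_eq hq R 1 (by rw [hl, hm, he]; field_simp))
    ((H 2 (-1) (-1) (-1) (-1) (-1) (by norm_num)).of_mul_pow_eq hq (2 * R) 2
      (by rw [hl, hm, he]; field_simp; ring))
  have z1 : q ^ (2 - ((R + 1 : ℕ) : ℤ)) = q / q ^ R := by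
    rw [show 2 - ((R + 1 : ℕ) : ℤ) = 1 - (R : ℤ) by push_cast; ring, zpow_sub₀ hq, zpow_one,
      zpow_natCast]
  have z2 : q ^ (4 - 2 * ((R + 1 : ℕ) : ℤ)) = (q / q ^ R) ^ 2 := by
    rw [show 4 - 2 * ((R + 1 : ℕ) : ℤ) = (2 - ((R + 1 : ℕ) : ℤ)) * (2 : ℕ) by push_cast; ring,
      zpow_mul, zpow_natCast, z1]
  have z3 : q ^ (1 - ((R + 1 : ℕ) : ℤ)) = (q ^ R)⁻¹ := by
    rw [show 1 - ((R + 1 : ℕ) : ℤ) = -(R : ℤ) by push_cast; ring, zpow_neg, zpow_natCast]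
  have z4 : ∀ k : ℕ, q ^ (1 - (k : ℤ)) = q / q ^ k := fun k => by
    rw [zpow_sub₀ hq, zpow_one, zpow_natCast]
  have z5 : ∀ k : ℕ, q ^ (((R + 1 : ℕ) : ℤ) - 1 - k) = q ^ R / q ^ k := fun k => by
    rw [show ((R + 1 : ℕ) : ℤ) - 1 - k = (R : ℤ) - k by push_cast; ring, zpow_sub₀ hq,
      zpow_natCast, zpow_natCast]
  have z6 : ∀ k : ℕ, q ^ (1 - ((R + 1 : ℕ) : ℤ) + 2 * (k : ℤ)) = q ^ (2 * k) / q ^ R := fun k => by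
    rw [show 1 - ((R + 1 : ℕ) : ℤ) + 2 * (k : ℤ) = ((2 * k : ℕ) : ℤ) - R by push_cast; ring,
      zpow_sub₀ hq, zpow_natCast, zpow_natCast]
  have z7 : ∀ k : ℕ, q ^ (2 - ((R + 1 : ℕ) : ℤ) - k) = q / (q ^ R * q ^ k) := fun k => by
    rw [zpow_sub₀ hq, z1, zpow_natCast, div_div]
  have z8 : ∀ k : ℕ, q ^ (2 - ((R + 1 : ℕ) : ℤ) + k) = q * q ^ k / q ^ R := fun k => by
    rw [zpow_add₀ hq, z1, zpow_natCast]; ring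
  have z9 : ∀ k : ℕ, q ^ (-(k : ℤ)) = (q ^ k)⁻¹ := fun k => by rw [zpow_neg, zpow_natCast]
  have z0 : e * (q ^ R)⁻¹ / b = e / (b * q ^ R) := by field_simp
  rw [crLHS_eq_crSum hq, h1, crSum_permute, h2, crRHS]
  simp only [z1, z2, z3, z4, z5, z6, z7, z8, z9, z0, Nat.add_sub_cancel]
  rw [sum_crRHS_eq_crSum hq ha hb hc hd he0 hf hg]
  have y1 : m * f / l = a * (q / q ^ R) / (b * g) := by rw [hm, hl, he]; field_simp
  have y2 : m * g / l = a * (q / q ^ R) / (b * f) := by rw [hm, hl, he]; field_simp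
  have y3 : m * (l * b / a) / l = e * (q ^ R)⁻¹ / a := by rw [hm]; field_simp
  have y4 : l * c / a = a * (q / q ^ R) / (b * d) := by rw [hl]; field_simp
  have y5 : l * d / a = a * (q / q ^ R) / (b * c) := by rw [hl]; field_simp
  -- The same number as in `y3`, rewritten by balancing: the prefactor is stated without `e`, the
  -- series with it.
  have y6 : m * (l * b / a) / l = a ^ 2 * (q / q ^ R) ^ 2 / (b * c * d * f * g) := by
    rw [hm, he]; field_simp
  have y7 : m / a = a ^ 2 * (q / q ^ R) ^ 2 / (b ^ 2 * c * d * f * g) := by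
    rw [hm, he]; field_simp
  have hLB : QGeneric q (l * b / a) :=
    (H 1 0 (-1) (-1) 0 0 (by norm_num)).of_mul_pow_eq hq R 1 (by rw [hl]; field_simp)
  -- The factorials of `l b / a` cancel between the two prefactors, and the index `s = 0`
  -- contributes `1`.
  have p1 : (∏ s ∈ range (R + 1), qPoch q b s * qPoch q c s * qPoch q d s /
        (qPoch q (l * b / a) s * qPoch q (l * c / a) s * qPoch q (l * d / a) s)) *
      (∏ s ∈ range (R + 1), qPoch q f s * qPoch q g s * qPoch q (l * b / a) s /
        (qPoch q (m * f / l) s * qPoch q (m * g / l) s * qPoch q (m * (l * b / a) / l) s)) =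
      ∏ i ∈ Icc 1 R, qPochs q [b, c, d, f, g] i /
        qPochs q [a * (q / q ^ R) / (b * c), a * (q / q ^ R) / (b * d),
          a * (q / q ^ R) / (b * f), a * (q / q ^ R) / (b * g),
          a ^ 2 * (q / q ^ R) ^ 2 / (b * c * d * f * g)] i := by
    rw [← prod_mul_distrib, prod_subset (s₁ := Icc 1 R) (s₂ := range (R + 1))]
    · refine prod_congr rfl fun s _ => ?_
      have h0 := hLB.qPoch_ne_zero s
      rw [y1, y2, y6, y4, y5]
      simp only [qPochs_cons, qPochs_nil, mul_one]
      rw [div_mul_div_comm]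
      refine div_eq_div_of_mul one_ne_zero h0 ?_ ?_ <;> ring
    · intro s hs
      rw [mem_Icc] at hs
      exact mem_range.2 (by omega)
    · intro s hs hs'
      have : s = 0 := by
        rw [mem_range] at hs
        rw [mem_Icc] at hs'
        omega
      rw [this, qPochs_zero, qPochs_zero, div_one]
  have p2 : (∏ i, baileyFactor q a l (e * q ^ n i) f (n i)) *
      (∏ i, baileyFactor q l m (e * q ^ n i) (l * c / a) (n i)) =
      ∏ i, qPochs q [a * q, a * (q / q ^ n i) / (c * e), a * (q / q ^ n i) / (d * e),
          a * (q / q ^ n i) / (e * f), a * (q / q ^ n i) / (e * g), b * q ^ R] (n i) /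
        qPochs q [a * q / c, a * q / d, a * (q / q ^ n i) / e, a * q / f, a * q / g,
          b * (q ^ R / q ^ n i) / e] (n i) * (e * q ^ n i) ^ n i := by
    rw [← prod_mul_distrib]
    refine prod_congr rfl fun i _ => ?_
    rw [baileyFactor_mul_baileyFactor hq ha hb hc hd he0 hf hg hl hm rfl he
      ((H 2 (-1) (-1) (-1) 0 0 (by norm_num)).of_mul_pow_eq hq R 1 (by rw [hl]; field_simp))
      ((H (-1) 0 0 0 1 1 (by norm_num)).of_mul_pow_eq hq 1 0 (by rw [hl, he]; field_simp))
      ((H 1 0 0 (-1) 0 0 (by norm_num)).of_mul_pow_eq hq 0 0 (by field_simp))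
      ((H 1 0 0 0 0 (-1) (by norm_num)).of_mul_pow_eq hq 0 0 (by field_simp))
      ((H 3 (-2) (-1) (-1) (-1) (-1) (by norm_num)).of_mul_pow_eq hq (2 * R) 2
        (by rw [hm, he]; field_simp; ring))]
    simp only [qPochs_cons, qPochs_nil, mul_one, ← mul_assoc]
  have p3 : (l / a) ^ ((R + 1).choose 2) * (m / l) ^ ((R + 1).choose 2) =
      (a ^ 2 * (q / q ^ R) ^ 2 / (b ^ 2 * c * d * f * g)) ^ ((R + 1).choose 2) := by
    rw [← mul_pow, ← y7]; congr 1; field_simp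
  rw [← p1, ← p2, ← p3, y1, y2, y3, ← y4, ← y5, ← hm]
  ring

/-! ### Continuity of both sides in the parameters -/

theorem continuousAt_qPoch {q : ℂ} {x : ℂ → ℂ} {t₀ : ℂ} (hx : ContinuousAt x t₀) (k : ℕ) :
    ContinuousAt (fun t => qPoch q (x t) k) t₀ := by
  unfold qPoch
  exact tendsto_finsetProd _ fun j _ => tendsto_const_nhds.sub (hx.mul tendsto_const_nhds)

theorem continuousAt_qPochs_nil {q t₀ : ℂ} (k : ℕ) :
    ContinuousAt (fun _ : ℂ => qPochs q [] k) t₀ := continuousAt_const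

theorem continuousAt_qPochs_cons {q : ℂ} {x : ℂ → ℂ} {l : ℂ → List ℂ} {t₀ : ℂ} {k : ℕ}
    (hx : ContinuousAt x t₀) (hl : ContinuousAt (fun t => qPochs q (l t) k) t₀) :
    ContinuousAt (fun t => qPochs q (x t :: l t) k) t₀ := by
  simp only [qPochs_cons]
  exact (continuousAt_qPoch hx k).mul hl

theorem continuousAt_crFactor {r : ℕ} {q : ℂ} {x : ℂ → ℂ} {t₀ : ℂ} (hx : ContinuousAt x t₀)
    (k : Fin r → ℕ) : ContinuousAt (fun t => crFactor q (x t) k) t₀ := by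
  unfold crFactor
  exact tendsto_finsetProd _ fun i _ => tendsto_finsetProd _ fun j _ =>
    tendsto_const_nhds.mul (tendsto_const_nhds.sub (hx.mul tendsto_const_nhds))

/-- Since `(x)_k` divides `(x)_n` for `k ≤ n`, nonvanishing at `k_i = n_i` covers all terms of the
sums. -/
theorem qPochs_ne_zero_of_le {q : ℂ} {l : List ℂ} {k n : ℕ} (h : qPochs q l n ≠ 0) (hk : k ≤ n) :
    qPochs q l k ≠ 0 := by
  induction l with
  | nil => simp [qPochs_nil]
  | cons x l ih =>
    rw [qPochs_cons] at h ⊢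
    refine mul_ne_zero ?_ (ih (right_ne_zero_of_mul h))
    have h1 := left_ne_zero_of_mul h
    rw [← Nat.add_sub_cancel' hk, qPoch_add] at h1
    exact left_ne_zero_of_mul h1

theorem continuousAt_crLHS {r : ℕ} {q : ℂ} (hq1 : ‖q‖ < 1) (n : Fin r → ℕ)
    {a b c d e f g : ℂ → ℂ} {t₀ : ℂ} (ha : ContinuousAt a t₀) (hb : ContinuousAt b t₀)
    (hc : ContinuousAt c t₀) (hd : ContinuousAt d t₀) (he : ContinuousAt e t₀)
    (hf : ContinuousAt f t₀) (hg : ContinuousAt g t₀) (hb0 : b t₀ ≠ 0) (hc0 : c t₀ ≠ 0)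
    (hd0 : d t₀ ≠ 0) (he0 : e t₀ ≠ 0) (hf0 : f t₀ ≠ 0) (hg0 : g t₀ ≠ 0)
    (hL₀ : 1 - a t₀ ≠ 0)
    (hL : ∀ i, qPochs q [a t₀ * q / b t₀, a t₀ * q / c t₀, a t₀ * q / d t₀, a t₀ * q ^ (1 - (n i : ℤ)) / e t₀,
      a t₀ * q / f t₀, a t₀ * q / g t₀, a t₀ * q ^ (1 + n i)] (n i) ≠ 0) :
    ContinuousAt (fun t => crLHS q n (a t) (b t) (c t) (d t) (e t) (f t) (g t)) t₀ := by
  unfold crLHS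
  refine tendsto_finsetSum _ fun k hk => ?_
  refine ((continuousAt_crFactor ha k).mul (tendsto_finsetProd _ fun i _ => ?_)).mul
    continuousAt_const
  have hki : k i ≤ n i := Nat.lt_succ_iff.1 (mem_range.1 (Fintype.mem_piFinset.1 hk i))
  refine ContinuousAt.div (ContinuousAt.mul (by fun_prop) ?_)
    (ContinuousAt.mul (by fun_prop) ?_) ?_
  · refine continuousAt_qPochs_cons ?_ (continuousAt_qPochs_cons ?_
      (continuousAt_qPochs_cons ?_ (continuousAt_qPochs_cons ?_
      (continuousAt_qPochs_cons ?_ (continuousAt_qPochs_cons ?_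
      (continuousAt_qPochs_cons ?_ (continuousAt_qPochs_cons ?_ (continuousAt_qPochs_nil _))))))))
    all_goals fun_prop (disch := positivity)
  · refine continuousAt_qPochs_cons ?_ (continuousAt_qPochs_cons ?_
      (continuousAt_qPochs_cons ?_ (continuousAt_qPochs_cons ?_
      (continuousAt_qPochs_cons ?_ (continuousAt_qPochs_cons ?_
      (continuousAt_qPochs_cons ?_ (continuousAt_qPochs_cons ?_ (continuousAt_qPochs_nil _))))))))
    all_goals fun_prop (disch := positivity)
  · rw [qPochs_cons]
    exact mul_ne_zero hL₀ (mul_ne_zero (qPoch_self_ne_zero hq1 _) (qPochs_ne_zero_of_le (hL i) hki))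

theorem continuousAt_crRHS {r : ℕ} {q : ℂ} (hq1 : ‖q‖ < 1) (n : Fin r → ℕ)
    {a b c d e f g : ℂ → ℂ} {t₀ : ℂ} (ha : ContinuousAt a t₀) (hb : ContinuousAt b t₀)
    (hc : ContinuousAt c t₀) (hd : ContinuousAt d t₀) (he : ContinuousAt e t₀)
    (hf : ContinuousAt f t₀) (hg : ContinuousAt g t₀) (ha0 : a t₀ ≠ 0) (hb0 : b t₀ ≠ 0)
    (hc0 : c t₀ ≠ 0) (hd0 : d t₀ ≠ 0) (he0 : e t₀ ≠ 0) (hf0 : f t₀ ≠ 0) (hg0 : g t₀ ≠ 0)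
    (hP₁ : ∀ i ∈ Icc 1 (r - 1), qPochs q [a t₀ * q ^ (2 - (r : ℤ)) / (b t₀ * c t₀),
      a t₀ * q ^ (2 - (r : ℤ)) / (b t₀ * d t₀), a t₀ * q ^ (2 - (r : ℤ)) / (b t₀ * f t₀),
      a t₀ * q ^ (2 - (r : ℤ)) / (b t₀ * g t₀),
      a t₀ ^ 2 * q ^ (4 - 2 * (r : ℤ)) / (b t₀ * c t₀ * d t₀ * f t₀ * g t₀)] i ≠ 0)
    (hP₂ : ∀ i, qPochs q [a t₀ * q / c t₀, a t₀ * q / d t₀, a t₀ * q ^ (1 - (n i : ℤ)) / e t₀, a t₀ * q / f t₀,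
      a t₀ * q / g t₀, b t₀ * q ^ ((r : ℤ) - 1 - n i) / e t₀] (n i) ≠ 0)
    (hR₀ : 1 - e t₀ * q ^ (1 - (r : ℤ)) / b t₀ ≠ 0)
    (hR : ∀ i, qPochs q [a t₀ * q / b t₀, e t₀ * f t₀ / a t₀, e t₀ * g t₀ / a t₀, q ^ (2 - (r : ℤ) - n i) / b t₀,
      e t₀ * c t₀ / a t₀, e t₀ * d t₀ / a t₀, e t₀ * q ^ (2 - (r : ℤ) + n i) / b t₀] (n i) ≠ 0) :
    ContinuousAt (fun t => crRHS q n (a t) (b t) (c t) (d t) (e t) (f t) (g t)) t₀ := by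
  unfold crRHS
  refine ((ContinuousAt.mul ?_ (tendsto_finsetProd _ fun i hi => ?_)).mul
    (tendsto_finsetProd _ fun i _ => ContinuousAt.mul ?_ ?_)).mul
    (tendsto_finsetSum _ fun k hk => ?_)
  · fun_prop (disch := positivity)
  · refine ContinuousAt.div (continuousAt_qPochs_cons ?_ (continuousAt_qPochs_cons ?_
      (continuousAt_qPochs_cons ?_ (continuousAt_qPochs_cons ?_
      (continuousAt_qPochs_cons ?_ (continuousAt_qPochs_nil _))))))
      (continuousAt_qPochs_cons ?_ (continuousAt_qPochs_cons ?_
      (continuousAt_qPochs_cons ?_ (continuousAt_qPochs_cons ?_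
      (continuousAt_qPochs_cons ?_ (continuousAt_qPochs_nil _))))))
      (hP₁ i hi)
    all_goals fun_prop (disch := positivity)
  · refine ContinuousAt.div (continuousAt_qPochs_cons ?_ (continuousAt_qPochs_cons ?_
      (continuousAt_qPochs_cons ?_ (continuousAt_qPochs_cons ?_
      (continuousAt_qPochs_cons ?_ (continuousAt_qPochs_cons ?_
      (continuousAt_qPochs_nil _))))))) (continuousAt_qPochs_cons ?_
      (continuousAt_qPochs_cons ?_ (continuousAt_qPochs_cons ?_
      (continuousAt_qPochs_cons ?_ (continuousAt_qPochs_cons ?_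
      (continuousAt_qPochs_cons ?_ (continuousAt_qPochs_nil _)))))))
      (hP₂ i)
    all_goals fun_prop (disch := positivity)
  · fun_prop
  have hki : ∀ i, k i ≤ n i := fun i =>
    Nat.lt_succ_iff.1 (mem_range.1 (Fintype.mem_piFinset.1 hk i))
  refine (((continuousAt_crFactor ?_ k).mul (tendsto_finsetProd _ fun i _ => ?_)).mul
    (tendsto_finsetProd _ fun i _ => ?_)).mul continuousAt_const
  · fun_prop (disch := positivity)
  · have h := qPochs_ne_zero_of_le (hR i) (hki i)
    simp only [qPochs_cons] at h
    refine ContinuousAt.div (ContinuousAt.mul ?_ ?_) (ContinuousAt.mul ?_ ?_) ?_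
    rotate_left 4
    · refine mul_ne_zero hR₀ ?_
      have := qPoch_self_ne_zero hq1 (k i)
      simp only [qPochs_cons, qPochs_nil]
      simp only [mul_ne_zero_iff] at h ⊢
      tauto
    · fun_prop (disch := positivity)
    · refine continuousAt_qPochs_cons ?_ (continuousAt_qPochs_cons ?_
        (continuousAt_qPochs_cons ?_ (continuousAt_qPochs_cons ?_ (continuousAt_qPochs_nil _))))
      all_goals fun_prop (disch := positivity)
    · fun_prop (disch := positivity)
    · refine continuousAt_qPochs_cons ?_ (continuousAt_qPochs_cons ?_
        (continuousAt_qPochs_cons ?_ (continuousAt_qPochs_cons ?_ (continuousAt_qPochs_nil _))))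
      all_goals fun_prop (disch := positivity)
  · have h := qPochs_ne_zero_of_le (hR i) (hki i)
    simp only [qPochs_cons] at h
    refine ContinuousAt.div ?_ ?_ ?_
    rotate_left 2
    · simp only [qPochs_cons, qPochs_nil]
      simp only [mul_ne_zero_iff] at h ⊢
      tauto
    · refine continuousAt_qPochs_cons ?_ (continuousAt_qPochs_cons ?_
        (continuousAt_qPochs_cons ?_ (continuousAt_qPochs_cons ?_ (continuousAt_qPochs_nil _))))
      all_goals fun_prop (disch := positivity)
    · refine continuousAt_qPochs_cons ?_ (continuousAt_qPochs_cons ?_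
        (continuousAt_qPochs_cons ?_ (continuousAt_qPochs_cons ?_ (continuousAt_qPochs_nil _))))
      all_goals fun_prop (disch := positivity)

/-! ### Density of generic parameters on a weighted curve -/

theorem finite_setOf_zpow_eq {w : ℤ} (hw : w ≠ 0) (D : ℂ) : {t : ℂ | t ^ w = D}.Finite := by
  have key : ∀ (m : ℕ) (D : ℂ), 0 < m → {t : ℂ | t ^ m = D}.Finite := fun m D hm =>
    (Polynomial.nthRoots m D).toFinset.finite_toSet.subset fun t ht => by
      simpa [Polynomial.mem_nthRoots hm] using ht
  obtain ⟨m, rfl | rfl⟩ := w.eq_nat_or_neg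
  · simpa using key m D (by omega)
  · refine (key m D⁻¹ (by omega)).subset fun t ht => ?_
    rw [Set.mem_ofPred_eq, zpow_neg, zpow_natCast] at ht
    rw [Set.mem_ofPred_eq, ← ht, inv_inv]

/-- A monomial of weight `w` is multiplied by `t^w` along the curve. A failure of genericity
therefore fixes `t^w` for some `w ≠ 0`, which leaves finitely many `t` for each of countably many
exponent vectors; the complement of a countable set is dense in `ℂ`. The unequal weights give ratios
such as `b / c` and `f / g` nonzero weight. -/
theorem dense_setOf_genericParams (q a b c d f g : ℂ) :
    Dense {t : ℂ | t ≠ 0 ∧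
      GenericParams q (a * t) (b * t ^ 2) (c * t ^ 3) (d * t ^ 2) (f * t ^ 2) (g * t ^ 3)} := by
  set S : Set ℂ := {0} ∪ ⋃ (i : ℤ × ℤ × ℤ × ℤ × ℤ × ℤ × ℤ), {t : ℂ |
    i.1 + 2 * i.2.1 + 3 * i.2.2.1 + 2 * i.2.2.2.1 + 2 * i.2.2.2.2.1 + 3 * i.2.2.2.2.2.1 ≠ 0 ∧
    t ^ (i.1 + 2 * i.2.1 + 3 * i.2.2.1 + 2 * i.2.2.2.1 + 2 * i.2.2.2.2.1 + 3 * i.2.2.2.2.2.1) =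
    (a ^ i.1 * b ^ i.2.1 * c ^ i.2.2.1 * d ^ i.2.2.2.1 * f ^ i.2.2.2.2.1 * g ^ i.2.2.2.2.2.1 *
      q ^ i.2.2.2.2.2.2)⁻¹} with hS
  have hSc : S.Countable := by
    refine (Set.countable_singleton _).union (Set.countable_iUnion fun i => ?_)
    by_cases hw : i.1 + 2 * i.2.1 + 3 * i.2.2.1 + 2 * i.2.2.2.1 + 2 * i.2.2.2.2.1 +
      3 * i.2.2.2.2.2.1 = 0
    · simp [hw]
    · exact ((finite_setOf_zpow_eq hw _).subset fun t ht => ht.2).countable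
  refine (hSc.dense_compl ℂ).mono fun t ht => ?_
  have ht0 : t ≠ 0 := fun h => ht (Or.inl h)
  refine ⟨ht0, fun i₁ i₂ i₃ i₄ i₅ i₆ hw j hj => ht (Or.inr (Set.mem_iUnion.2
    ⟨(i₁, i₂, i₃, i₄, i₅, i₆, j), hw, ?_⟩))⟩
  refine eq_inv_of_mul_eq_one_left ?_
  rw [← hj]
  have e : ∀ (m : ℕ) (i : ℤ), (t ^ m) ^ i = t ^ (m * i : ℤ) := fun m i => by
    rw [zpow_mul, zpow_natCast]
  simp only [mul_zpow, e, zpow_add₀ ht0]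
  push_cast
  ring

/-! ### Removal of the genericity assumption -/

theorem corollary5p2 (r : ℕ) (hr : 1 ≤ r) (q : ℂ) (hq0 : 0 < ‖q‖) (hq1 : ‖q‖ < 1)
    (n : Fin r → ℕ) (a b c d e f g : ℂ)
    -- together with the balancing condition this makes all seven parameters nonzero
    (ha : a ≠ 0)
    (hbal : b * c * d * e * f * g = a ^ 3 * q ^ (3 - (r : ℤ)))
    -- no denominator of the left-hand side vanishes
    (hL₀ : 1 - a ≠ 0)
    (hL : ∀ i, qPochs q [a * q / b, a * q / c, a * q / d, a * q ^ (1 - (n i : ℤ)) / e,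
      a * q / f, a * q / g, a * q ^ (1 + n i)] (n i) ≠ 0)
    -- no denominator of the prefactor on the right-hand side vanishes
    (hP₁ : ∀ i ∈ Icc 1 (r - 1), qPochs q [a * q ^ (2 - (r : ℤ)) / (b * c),
      a * q ^ (2 - (r : ℤ)) / (b * d), a * q ^ (2 - (r : ℤ)) / (b * f),
      a * q ^ (2 - (r : ℤ)) / (b * g),
      a ^ 2 * q ^ (4 - 2 * (r : ℤ)) / (b * c * d * f * g)] i ≠ 0)
    (hP₂ : ∀ i, qPochs q [a * q / c, a * q / d, a * q ^ (1 - (n i : ℤ)) / e, a * q / f,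
      a * q / g, b * q ^ ((r : ℤ) - 1 - n i) / e] (n i) ≠ 0)
    -- no denominator of the sum on the right-hand side vanishes
    (hR₀ : 1 - e * q ^ (1 - (r : ℤ)) / b ≠ 0)
    (hR : ∀ i, qPochs q [a * q / b, e * f / a, e * g / a, q ^ (2 - (r : ℤ) - n i) / b,
      e * c / a, e * d / a, e * q ^ (2 - (r : ℤ) + n i) / b] (n i) ≠ 0) :
    ∑ k ∈ multiBox n,
        crFactor q a k *
          (∏ i, (1 - a * q ^ (2 * k i)) *
            qPochs q [a, b, c, d, e * q ^ n i, f, g, q ^ (-(n i : ℤ))] (k i) /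
            ((1 - a) *
              qPochs q [q, a * q / b, a * q / c, a * q / d, a * q ^ (1 - (n i : ℤ)) / e,
                a * q / f, a * q / g, a * q ^ (1 + n i)] (k i))) *
          q ^ (∑ i, k i)
      = (a ^ 2 * q ^ (4 - 2 * (r : ℤ)) / (b ^ 2 * c * d * f * g)) ^ (r.choose 2) *
        (∏ i ∈ Icc 1 (r - 1),
          qPochs q [b, c, d, f, g] i /
            qPochs q [a * q ^ (2 - (r : ℤ)) / (b * c), a * q ^ (2 - (r : ℤ)) / (b * d),
              a * q ^ (2 - (r : ℤ)) / (b * f), a * q ^ (2 - (r : ℤ)) / (b * g),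
              a ^ 2 * q ^ (4 - 2 * (r : ℤ)) / (b * c * d * f * g)] i) *
        (∏ i,
          qPochs q [a * q, a * q ^ (1 - (n i : ℤ)) / (c * e), a * q ^ (1 - (n i : ℤ)) / (d * e),
              a * q ^ (1 - (n i : ℤ)) / (e * f), a * q ^ (1 - (n i : ℤ)) / (e * g),
              b * q ^ (r - 1)] (n i) /
            qPochs q [a * q / c, a * q / d, a * q ^ (1 - (n i : ℤ)) / e, a * q / f,
              a * q / g, b * q ^ ((r : ℤ) - 1 - n i) / e] (n i) *
            (e * q ^ n i) ^ n i) *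
        ∑ k ∈ multiBox n,
          crFactor q (e * q ^ (1 - (r : ℤ)) / b) k *
            (∏ i, (1 - e * q ^ (1 - (r : ℤ) + 2 * k i) / b) *
              qPochs q [e * q ^ (1 - (r : ℤ)) / b, e * q ^ (1 - (r : ℤ)) / a,
                a * q ^ (2 - (r : ℤ)) / (b * f), a * q ^ (2 - (r : ℤ)) / (b * g)] (k i) /
              ((1 - e * q ^ (1 - (r : ℤ)) / b) *
                qPochs q [q, a * q / b, e * f / a, e * g / a] (k i))) *
            (∏ i,
              qPochs q [e * q ^ n i, a * q ^ (2 - (r : ℤ)) / (b * c),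
                a * q ^ (2 - (r : ℤ)) / (b * d), q ^ (-(n i : ℤ))] (k i) /
              qPochs q [q ^ (2 - (r : ℤ) - n i) / b, e * c / a, e * d / a,
                e * q ^ (2 - (r : ℤ) + n i) / b] (k i)) *
            q ^ (∑ i, k i) := by
  obtain ⟨R, rfl⟩ : ∃ R, r = R + 1 := ⟨r - 1, (Nat.sub_add_cancel hr).symm⟩
  have hq : q ≠ 0 := norm_pos_iff.1 hq0
  have hqR : q ^ R ≠ 0 := pow_ne_zero _ hq
  have hz : q ^ (3 - ((R + 1 : ℕ) : ℤ)) = q ^ 2 / q ^ R := by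
    rw [show 3 - ((R + 1 : ℕ) : ℤ) = (2 : ℕ) - (R : ℤ) by push_cast; ring, zpow_sub₀ hq,
      zpow_natCast, zpow_natCast]
  rw [hz] at hbal
  have hprod : b * c * d * e * f * g ≠ 0 := by rw [hbal]; positivity
  simp only [mul_ne_zero_iff] at hprod
  obtain ⟨⟨⟨⟨⟨hb, hc⟩, hd⟩, he⟩, hf⟩, hg⟩ := hprod
  change crLHS q n a b c d e f g = crRHS q n a b c d e f g
  have he' : e = a ^ 3 * q ^ 2 / (b * c * d * f * g * q ^ R) := by
    rw [eq_div_iff (by positivity)]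
    rw [mul_div_assoc', eq_div_iff hqR] at hbal
    linear_combination hbal
  -- The curve passes through the given parameters at `t = 1`; `e'` is defined by solving the
  -- balancing condition, so balancing holds at every `t ≠ 0`.
  obtain ⟨a', ha'⟩ : ∃ a' : ℂ → ℂ, a' = fun t => a * t := ⟨_, rfl⟩
  obtain ⟨b', hb'⟩ : ∃ b' : ℂ → ℂ, b' = fun t => b * t ^ 2 := ⟨_, rfl⟩
  obtain ⟨c', hc'⟩ : ∃ c' : ℂ → ℂ, c' = fun t => c * t ^ 3 := ⟨_, rfl⟩
  obtain ⟨d', hd'⟩ : ∃ d' : ℂ → ℂ, d' = fun t => d * t ^ 2 := ⟨_, rfl⟩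
  obtain ⟨f', hf'⟩ : ∃ f' : ℂ → ℂ, f' = fun t => f * t ^ 2 := ⟨_, rfl⟩
  obtain ⟨g', hg'⟩ : ∃ g' : ℂ → ℂ, g' = fun t => g * t ^ 3 := ⟨_, rfl⟩
  obtain ⟨e', hee'⟩ : ∃ e' : ℂ → ℂ, e' = fun t =>
    a' t ^ 3 * q ^ 2 / (b' t * c' t * d' t * f' t * g' t * q ^ R) := ⟨_, rfl⟩
  have dense := dense_setOf_genericParams q a b c d f g
  have ha1 : a = a' 1 := by rw [ha']; simp
  have hb1 : b = b' 1 := by rw [hb']; simp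
  have hc1 : c = c' 1 := by rw [hc']; simp
  have hd1 : d = d' 1 := by rw [hd']; simp
  have hf1 : f = f' 1 := by rw [hf']; simp
  have hg1 : g = g' 1 := by rw [hg']; simp
  have he1 : e = e' 1 := by simp only [hee', ← ha1, ← hb1, ← hc1, ← hd1, ← hf1, ← hg1, he']
  have hgen : ∀ t ∈ {t : ℂ | t ≠ 0 ∧
      GenericParams q (a * t) (b * t ^ 2) (c * t ^ 3) (d * t ^ 2) (f * t ^ 2) (g * t ^ 3)},
      crLHS q n (a' t) (b' t) (c' t) (d' t) (e' t) (f' t) (g' t) =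
      crRHS q n (a' t) (b' t) (c' t) (d' t) (e' t) (f' t) (g' t) := by
    rintro t ⟨ht, h⟩
    refine crLHS_eq_crRHS_of_generic hq hq1 n ?_ ?_ ?_ ?_ ?_ ?_ (by rw [hee']) ?_
    · rw [ha']; positivity
    · rw [hb']; positivity
    · rw [hc']; positivity
    · rw [hd']; positivity
    · rw [hf']; positivity
    · rw [hg']; positivity
    · rw [ha', hb', hc', hd', hf', hg']; exact h
  have ca : ContinuousAt a' 1 := by rw [ha']; fun_prop
  have cb : ContinuousAt b' 1 := by rw [hb']; fun_prop
  have cc : ContinuousAt c' 1 := by rw [hc']; fun_prop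
  have cd : ContinuousAt d' 1 := by rw [hd']; fun_prop
  have cf : ContinuousAt f' 1 := by rw [hf']; fun_prop
  have cg : ContinuousAt g' 1 := by rw [hg']; fun_prop
  rw [ha1] at ha
  rw [hb1] at hb
  rw [hc1] at hc
  rw [hd1] at hd
  rw [hf1] at hf
  rw [hg1] at hg
  have ce : ContinuousAt e' 1 := by rw [hee']; fun_prop (disch := positivity)
  clear hbal hz he' ha' hb' hc' hd' hf' hg' hee'
  generalize {t : ℂ | t ≠ 0 ∧
      GenericParams q (a * t) (b * t ^ 2) (c * t ^ 3) (d * t ^ 2) (f * t ^ 2) (g * t ^ 3)} = S at *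
  subst ha1 hb1 hc1 hd1 he1 hf1 hg1
  have hL' := (continuousAt_crLHS hq1 n ca cb cc cd ce cf cg hb hc hd he hf hg hL₀ hL).tendsto
  have hR' := (continuousAt_crRHS hq1 n ca cb cc cd ce cf cg ha hb hc hd he hf hg hP₁ hP₂ hR₀
    hR).tendsto
  -- The point `1` itself need not be generic; it only has to be a limit of generic points, and both
  -- sides are continuous there.
  have : (𝓝[S] (1 : ℂ)).NeBot := mem_closure_iff_nhdsWithin_neBot.1 (dense 1)
  refine tendsto_nhds_unique (hL'.mono_left (nhdsWithin_le_nhds (s := S))) ?_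
  refine (hR'.mono_left nhdsWithin_le_nhds).congr' ?_
  filter_upwards [self_mem_nhdsWithin] with t ht
  exact (hgen t ht).symm
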